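/- Let $N\in\mathbb N$, let $C_N^A=\{x\in\mathbb R^N: x_1\ge\dots\ge x_N\}$, and let $z_1>\dots>z_N$ be the ordered zeros of the Hermite polynomial $H_N$ (orthogonal with respect to the density $e^{-x^2}$), $z=(z_1,\dots,z_N)$. Let $E$ be the $N\times N$ identity matrix and let $A\in\mathbb R^{N\times N}$ be given by $$A_{i,j}=\frac1{(z_i-z_j)^2}\ (i\ne j),\qquad A_{i,i}=-\sum_{j\ne i}\frac1{(z_i-z_j)^2}.$$ Let $\lambda\in\mathbb R\setminus\{0\}$, $c>0$, $y\in\mathbb R^N$, and let $k_0\ge 1/2$ be such that $\sqrt k\,cz+y$ lies in the interior of $C_N^A$ for all $k\ge k_0$. Let $(B_t)_{t\ge0}$ be an $N$-dimensional standard Brownian motion and, for $k\ge k_0$, let $(Y_{t,k})_{t\ge0}$ be a continuous $C_N^A$-valued solution, with drift a.s. integrable on bounded time intervals, of $$dY^i_{t,k}=dB^i_t+\Bigl(k\sum_{j\ne i}\frac1{Y^i_{t,k}-Y^j_{t,k}}-\lambda Y^i_{t,k}\Bigr)dt\quad(i=1,\dots,N),\qquad Y_{0,k}=\sqrt k\,cz+y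 .$$ For $x$ in the interior of $C_N^A$ let $\phi(t,x)$, $t\ge0$, be the unique solution in the interior of $C_N^A$ of the ODE $\dot x_i=\sum_{j\ne i}1/(x_i-x_j)$ with $\phi(0,x)=x$. Put $$\psi(t)=\phi\Bigl(\frac{1-e^{-2\lambda t}}{2\lambda},\,e^{-\lambda t}cz\Bigr),$$ let $A^\lambda(t)\in\mathbb R^{N\times N}$ have the entries $(\psi_i(t)-\psi_j(t))^{-2}$ for $i\neq j$ and $-\sum_{j\ne i}(\psi_i(t)-\psi_j(t))^{-2}-\lambda$ on the diagonal, and consider the linear SDE $$dW_t=dB_t+A^\lambda(t)W_t\,dt .\qquad(*)$$ Then the following hold. (1) The continuous solution $W$ of $(*)$ with $W_0=y$ is the limit process of the $Y_{\cdot,k}$: for every sequence $k_n\ge k_0$ with $k_n\to\infty$, almost surely $\sqrt{k_n}\,\bigl(Y_{t,k_n}/\sqrt{k_n}-\psi(t)\bigr)\to W_t$ locally uniformly in $t\ge0$. (2) $E-A$ is invertible and, for every continuous solution $W$ of $(*)$ with deterministic initial value (in particular for the limit process in (1), and for $W_0=0$), the components of $W_t$ are square integrable and the covariance matrix $\Sigma^\lambda_t$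 of $W_t$ is, for every $t>0$, $$\Sigma^\lambda_t=\frac{1+e^{-2\lambda t}(\lambda c^2-1)}{2\lambda}\,(E-A)^{-1}\Bigl(E-\exp\Bigl(\ln\Bigl(\frac{\lambda c^2}{e^{2\lambda t}-1+\lambda c^2}\Bigr)(E-A)\Bigr)\Bigr).$$ -/

import Mathlib

open MeasureTheory ProbabilityTheory Filter
open scoped NNReal

namespace BesselOU

noncomputable section

/-- The Hermite polynomials orthogonal with respect to the density `exp (-x ^ 2)`, given by
`H 0 = 1` and `H (n + 1) = 2 x H n - (H n)'`. -/
def hermitePoly : ℕ → Polynomial ℝ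
  | 0 => 1
  | n + 1 => 2 * Polynomial.X * hermitePoly n - Polynomial.derivative (hermitePoly n)

/-- `z` is the vector of the zeros of the Hermite polynomial `H N` in decreasing order: since `H N`
has degree `N`, a strictly decreasing `N`-tuple of zeros contains all of them. -/
def IsHermiteZeros {N : ℕ} (z : Fin N → ℝ) : Prop :=
  StrictAnti z ∧ ∀ i, (hermitePoly N).IsRoot (z i)

/-- The closed Weyl chamber `x 0 ≥ x 1 ≥ ... ≥ x (N - 1)` of type `A`. -/
def chamber (N : ℕ) : Set (Fin N → ℝ) := {x | Antitone x}

/-- The repulsion field `H x`, with `i`-th entry the sum over `j ≠ i` of `1 / (x i - x j)`. -/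
def repulsion {N : ℕ} (x : Fin N → ℝ) : Fin N → ℝ :=
  fun i => ∑ j ∈ Finset.univ.erase i, 1 / (x i - x j)

/-- `u` solves the ODE `u' = H u` on `[0, ∞)` inside the open Weyl chamber, with `u 0 = x`. -/
structure IsFlowLine {N : ℕ} (x : Fin N → ℝ) (u : ℝ → Fin N → ℝ) : Prop where
  start : u 0 = x
  mem : ∀ t, 0 ≤ t → u t ∈ interior (chamber N)
  deriv : ∀ t, 0 ≤ t → HasDerivWithinAt u (repulsion (u t)) (Set.Ici 0) t

open Classical in
/-- The flow `φ (t, x)` of `x' = H x`: the value at time `t ≥ 0` of the (unique) solution that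
starts at the point `x` of the open chamber. -/
def flow {N : ℕ} (t : ℝ) (x : Fin N → ℝ) : Fin N → ℝ :=
  if h : ∃ u, IsFlowLine x u then h.choose t else 0

/-- The deterministic limit `φ ((1 - exp (-2 lam t)) / (2 lam), exp (-lam t) x)`, which solves
`u' = H u - lam u` with start in `x`. -/
def flowOU {N : ℕ} (lam : ℝ) (x : Fin N → ℝ) (t : ℝ) : Fin N → ℝ :=
  flow ((1 - Real.exp (-2 * lam * t)) / (2 * lam)) (Real.exp (-lam * t) • x)

/-- The matrix with entries `1 / (x i - x j) ^ 2` off the diagonal, and whose rows sum to `0`. -/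
def interactionMatrix {N : ℕ} (x : Fin N → ℝ) : Matrix (Fin N) (Fin N) ℝ :=
  Matrix.of fun i j =>
    if i = j then -∑ l ∈ Finset.univ.erase i, 1 / (x i - x l) ^ 2 else 1 / (x i - x j) ^ 2

/-- The matrix `A^lam (t, x)`. -/
def driftMatrix {N : ℕ} (lam : ℝ) (x : Fin N → ℝ) (t : ℝ) : Matrix (Fin N) (Fin N) ℝ :=
  interactionMatrix (flowOU lam x t) - lam • 1

variable {Ω : Type*} [MeasurableSpace Ω]

/-- `B` is an `N`-dimensional standard Brownian motion (started at `0`) under `P`. -/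
structure IsBrownian {N : ℕ} (B : ℝ≥0 → Ω → Fin N → ℝ) (P : Measure Ω) : Prop where
  coord : ∀ i, IsBrownianReal (fun t ω => B t ω i) P
  indep : iIndepFun (fun (i : Fin N) (ω : Ω) (t : ℝ≥0) => B t ω i) P

/-- The drift `k H y - lam y` of the Bessel process of type `A` with multiplicity `k` and an
additional Ornstein-Uhlenbeck component. -/
def besselDrift {N : ℕ} (lam k : ℝ) (y : Fin N → ℝ) : Fin N → ℝ :=
  fun i => k * repulsion y i - lam * y i

/-- `Y` is a solution, in the closed Weyl chamber and with start in `y₀`, of the SDE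
`dY = dB + (k H Y - lam Y) dt`. As the noise is additive, the SDE is the usual integral equation
along almost every path, the singular drift being integrable in time. -/
def IsBesselOU {N : ℕ} (lam k : ℝ) (y₀ : Fin N → ℝ) (B Y : ℝ≥0 → Ω → Fin N → ℝ)
    (P : Measure Ω) : Prop :=
  ∀ᵐ ω ∂P, Continuous (fun t => Y t ω) ∧ (∀ t, Y t ω ∈ chamber N) ∧
    ∀ (t : ℝ≥0) (i : Fin N),
      IntervalIntegrable (fun s : ℝ => besselDrift lam k (Y s.toNNReal ω) i) volume 0 t ∧
      Y t ω i = y₀ i + B t ω i + ∫ s in (0 : ℝ)..t, besselDrift lam k (Y s.toNNReal ω) i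

/-- `W` is a solution, with start in `w`, of the linear SDE `dW = dB + A^lam (t, x) W dt`. As the
noise is additive, the SDE is the usual integral equation along almost every path. -/
def IsFluctuation {N : ℕ} (lam : ℝ) (x w : Fin N → ℝ) (B W : ℝ≥0 → Ω → Fin N → ℝ)
    (P : Measure Ω) : Prop :=
  ∀ᵐ ω ∂P, Continuous (fun t => W t ω) ∧
    ∀ (t : ℝ≥0) (i : Fin N),
      W t ω i = w i + B t ω i +
        ∫ s in (0 : ℝ)..t, (driftMatrix lam x s).mulVec (W s.toNNReal ω) i

/-- The covariance matrix of a random vector. -/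
def covMatrix {N : ℕ} (X : Ω → Fin N → ℝ) (P : Measure Ω) : Matrix (Fin N) (Fin N) ℝ :=
  Matrix.of fun i j => cov[fun ω => X ω i, fun ω => X ω j; P]

end

end BesselOU

/-! The problem becomes explicit because `z` is a central configuration of the repulsion field `H`:
the Hermite differential equation, read at a zero, gives `H z = z`. As `H` is homogeneous of degree
-1, the ray through `z` is invariant, and uniqueness of the flow identifies the limit as `ψ = r z`
with `r' = 1 / r - lam r`.

Convergence. The noise is additive, so `D = √k (Y / √k - ψ)` solves, path by path, an integral
equation with start in `y`, the same `B`, and drift `√k (H (ψ + D / √k) - H ψ) - lam D`. On `[0, T]`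
the gaps of `ψ` are bounded below; in a tube around `ψ` the drift therefore has linear growth in
`D`, uniformly in `k`, and differs from its linearization `A^lam D` by `O(‖D‖² / √k)`. Gronwall's
inequality up to the exit from the tube bounds `D` independently of `k`, and for large `k` this
bound rules the exit out (`norm_deviation_le`). A second use of Gronwall gives `D - W = O(1 / √k)`
(`norm_deviation_sub_le`).

Covariance. Since `ψ = r z`, the drift matrix is `r⁻² A - lam`. These matrices commute at different
times, so the adjoint equation with terminal value `u` at time `t` is solved by exponentials of `A`.
Pairing its solution `f` with `W` leaves `u ⬝ᵥ W t = f 0 ⬝ᵥ w + ∫ f dB`, a Gaussian variable of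
variance `∫ f ⬝ᵥ f`. The Wiener integral is written by integration by parts, and its law is obtained
from Riemann sums (`IsBrownian.hasLaw_integral`). The variance integrand is an exact derivative
(`integral_adjointFlow_dotProduct_self`), and polarization turns variances into covariances. -/

namespace BesselOU

/-! ### Hermite polynomials and their zeros -/

open Polynomial in
lemma derivative_hermitePoly_succ (n : ℕ) :
    derivative (hermitePoly (n + 1)) = 2 * ((n : ℝ[X]) + 1) * hermitePoly n := by
  induction n with
  | zero => simp [hermitePoly]
  | succ n ih =>
    rw [hermitePoly, derivative_sub, ih]
    simp only [derivative_mul, derivative_X, derivative_ofNat, derivative_natCast, derivative_add,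
      derivative_one, ih]
    rw [hermitePoly]
    push_cast
    ring

open Polynomial in
/-- The Hermite differential equation `H'' - 2 x H' + 2 n H = 0`. -/
lemma hermitePoly_ode (n : ℕ) :
    derivative (derivative (hermitePoly n)) - 2 * X * derivative (hermitePoly n)
      + 2 * (n : ℝ[X]) * hermitePoly n = 0 := by
  cases n with
  | zero => simp [hermitePoly]
  | succ n =>
    rw [derivative_hermitePoly_succ]
    simp only [derivative_mul, derivative_ofNat, derivative_natCast, derivative_add,
      derivative_one]
    rw [hermitePoly]
    push_cast
    ring

open Polynomial in
lemma natDegree_hermitePoly_le (n : ℕ) : (hermitePoly n).natDegree ≤ n := by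
  induction n with
  | zero => simp [hermitePoly]
  | succ n ih =>
    rw [hermitePoly]
    refine (natDegree_sub_le _ _).trans (max_le ?_ ?_)
    · rw [add_comm]
      refine natDegree_mul_le_of_le ?_ ih
      rw [show (2 : ℝ[X]) = C 2 from (map_ofNat C 2).symm]
      exact (natDegree_C_mul_le _ _).trans natDegree_X_le
    · exact (natDegree_derivative_le _).trans (by omega)

open Polynomial in
lemma coeff_hermitePoly_self (n : ℕ) : (hermitePoly n).coeff n = 2 ^ n := by
  induction n with
  | zero => simp [hermitePoly]
  | succ n ih =>
    rw [hermitePoly, coeff_sub, mul_assoc, ← C_ofNat, coeff_C_mul, coeff_X_mul, ih,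
      coeff_derivative, coeff_eq_zero_of_natDegree_lt]
    · ring
    · exact (natDegree_hermitePoly_le n).trans_lt (by omega)

variable {N : ℕ}

-- The `N` distinct linear factors are pairwise coprime divisors, and the degree bound leaves room
-- only for a constant cofactor.
open Polynomial in
lemma hermitePoly_eq_prod {z : Fin N → ℝ} (hz : IsHermiteZeros z) :
    hermitePoly N = C ((hermitePoly N).leadingCoeff) * ∏ i, (X - C (z i)) := by
  refine eq_leadingCoeff_mul_of_monic_of_dvd_of_natDegree_le
    (monic_prod_of_monic _ _ fun i _ => monic_X_sub_C _) ?_ ?_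
  · refine Finset.prod_dvd_of_coprime ?_ fun i _ => dvd_iff_isRoot.2 (hz.2 i)
    intro i _ j _ hij
    exact pairwise_coprime_X_sub_C hz.1.injective hij
  · simpa using natDegree_hermitePoly_le N

open Polynomial in
lemma hermitePoly_ne_zero (n : ℕ) : hermitePoly n ≠ 0 := by
  intro h
  have := coeff_hermitePoly_self n
  rw [h, coeff_zero] at this
  exact (pow_ne_zero n two_ne_zero) this.symm

/-- The zeros of the Hermite polynomial are a stationary point of `x' = H x - x`. -/
lemma repulsion_hermiteZeros {z : Fin N → ℝ} (hz : IsHermiteZeros z) : repulsion z = z := by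
  open Polynomial in
  funext i
  set c := (hermitePoly N).leadingCoeff with hc
  have hc0 : c ≠ 0 := leadingCoeff_ne_zero.2 (hermitePoly_ne_zero N)
  set Q : ℝ[X] := ∏ j ∈ Finset.univ.erase i, (X - C (z j)) with hQ
  have hH : hermitePoly N = C c * ((X - C (z i)) * Q) := by
    rw [hQ, Finset.mul_prod_erase _ (fun j => X - C (z j)) (Finset.mem_univ i)]
    exact hermitePoly_eq_prod hz
  have hQ0 : Q.eval (z i) ≠ 0 := by
    rw [hQ, eval_prod, Finset.prod_ne_zero_iff]
    intro j hj
    simp only [eval_sub, eval_X, eval_C]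
    exact sub_ne_zero.2 fun h => (Finset.ne_of_mem_erase hj) (hz.1.injective h).symm
  -- The repulsion at `z i` is the logarithmic derivative of the cofactor `Q`.
  have hQ' : (derivative Q).eval (z i) = Q.eval (z i) * repulsion z i := by
    rw [hQ, derivative_prod_finset, eval_finsetSum, repulsion, Finset.mul_sum]
    refine Finset.sum_congr rfl fun j hj => ?_
    have hne : z i - z j ≠ 0 :=
      sub_ne_zero.2 fun h => (Finset.ne_of_mem_erase hj) (hz.1.injective h).symm
    rw [← Finset.mul_prod_erase _ _ hj]
    simp only [derivative_sub, derivative_X, derivative_C, sub_zero, mul_one, eval_mul, eval_sub,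
      eval_X, eval_C]
    field_simp
  -- With `H = c (X - z i) Q`, at `z i` one has `H = 0`, `H' = c Q` and `H'' = 2 c Q'`, so the
  -- equation becomes `2 c Q (repulsion z i - z i) = 0`.
  have hode := congrArg (eval (z i)) (hermitePoly_ode N)
  rw [hH] at hode
  simp [derivative_mul, hQ'] at hode
  have h2 : c * Q.eval (z i) * (repulsion z i - z i) = 0 := by linarith
  have h3 := (mul_eq_zero.1 h2).resolve_left (mul_ne_zero hc0 hQ0)
  linarith

/-! ### The repulsion flow and its explicit solution along the ray of `z` -/

lemma strictAnti_of_mem_interior {x : Fin N → ℝ} (hx : x ∈ interior (chamber N)) :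
    StrictAnti x := by
  intro i j hij
  refine lt_of_le_of_ne (interior_subset hx hij.le) fun h => ?_
  -- If `x i = x j` with `i < j`, lowering entry `i` by any `e > 0` leaves the chamber.
  have hcont : Continuous fun e : ℝ => Function.update x i (x i - e) :=
    continuous_const.update i (by fun_prop)
  have hmem : ∀ᶠ e in nhds (0 : ℝ), Function.update x i (x i - e) ∈ chamber N := by
    have := hcont.continuousAt (x := 0)
    refine this.eventually ?_
    simpa using mem_interior_iff_mem_nhds.1 hx
  have hmem' : ∀ᶠ e in nhdsWithin (0 : ℝ) (Set.Ioi 0),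
      Function.update x i (x i - e) ∈ chamber N := hmem.filter_mono nhdsWithin_le_nhds
  obtain ⟨e, he, he0⟩ := (hmem'.and self_mem_nhdsWithin).exists
  have := he hij.le
  rw [Function.update_self, Function.update_of_ne hij.ne'] at this
  have : (0 : ℝ) < e := he0
  linarith

lemma mem_interior_of_strictAnti {x : Fin N → ℝ} (hx : StrictAnti x) :
    x ∈ interior (chamber N) := by
  refine mem_interior.2 ⟨⋂ i, ⋂ j, ⋂ _ : i < j, {y : Fin N → ℝ | y j < y i}, ?_, ?_, ?_⟩
  · intro y hy
    refine StrictAnti.antitone fun i j hij => ?_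
    simp only [Set.mem_iInter, Set.mem_ofPred_eq] at hy
    exact hy i j hij
  · refine isOpen_iInter_of_finite fun i => isOpen_iInter_of_finite fun j =>
      isOpen_iInter_of_finite fun _ => isOpen_lt (continuous_apply j) (continuous_apply i)
  · simp only [Set.mem_iInter, Set.mem_ofPred_eq]
    exact fun i j hij => hx hij

lemma repulsion_smul (a : ℝ) (x : Fin N → ℝ) : repulsion (a • x) = a⁻¹ • repulsion x := by
  funext i
  simp only [repulsion, Pi.smul_apply, smul_eq_mul, Finset.mul_sum]
  refine Finset.sum_congr rfl fun j _ => ?_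
  rw [← mul_sub, one_div, mul_inv, one_div]

/-- The repulsion field is monotone decreasing on the open chamber. -/
lemma sum_repulsion_sub_mul_sub_nonpos {x y : Fin N → ℝ} (hx : StrictAnti x) (hy : StrictAnti y) :
    ∑ i, (repulsion x i - repulsion y i) * (x i - y i) ≤ 0 := by
  set f : Fin N → Fin N → ℝ := fun i j => 1 / (x i - x j) - 1 / (y i - y j) with hf
  have hr : ∀ i, repulsion x i - repulsion y i = ∑ j, f i j := by
    intro i
    rw [repulsion, repulsion, ← Finset.sum_sub_distrib,
      ← Finset.add_sum_erase _ _ (Finset.mem_univ i)]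
    simp [hf]
  have hanti : ∀ i j, f i j = -f j i := by
    intro i j
    simp only [hf]
    rw [← neg_sub (x j) (x i), ← neg_sub (y j) (y i), one_div_neg_eq_neg_one_div,
      one_div_neg_eq_neg_one_div]
    ring
  have h1 : ∑ i, (repulsion x i - repulsion y i) * (x i - y i)
      = ∑ i, ∑ j, f i j * (x i - y i) := by
    simp_rw [hr, Finset.sum_mul]
  -- Symmetrization: as `f` is antisymmetric, twice the sum in question is the sum of `f i j`
  -- against differences of gaps, whose terms are nonpositive because corresponding gaps of `x` and
  -- `y` have the same sign.
  have h2 : ∑ i, ∑ j, f i j * (x i - y i) = -∑ i, ∑ j, f i j * (x j - y j) := by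
    rw [Finset.sum_comm, ← Finset.sum_neg_distrib]
    refine Finset.sum_congr rfl fun i _ => ?_
    rw [← Finset.sum_neg_distrib]
    refine Finset.sum_congr rfl fun j _ => ?_
    rw [hanti]; ring
  have h3 : ∑ i, ∑ j, f i j * ((x i - x j) - (y i - y j)) ≤ 0 := by
    refine Finset.sum_nonpos fun i _ => Finset.sum_nonpos fun j _ => ?_
    have key : ∀ a b : ℝ, 0 < a * b → (1 / a - 1 / b) * (a - b) ≤ 0 := by
      intro a b hab
      have ha : a ≠ 0 := left_ne_zero_of_mul hab.ne'
      have hb : b ≠ 0 := right_ne_zero_of_mul hab.ne'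
      have : (1 / a - 1 / b) * (a - b) = -((a - b) ^ 2 / (a * b)) := by
        field_simp
        ring
      rw [this]
      have := div_nonneg (sq_nonneg (a - b)) hab.le
      linarith
    rcases lt_trichotomy i j with h | h | h
    · exact key _ _ (mul_pos (sub_pos.2 (hx h)) (sub_pos.2 (hy h)))
    · subst h; simp
    · exact key _ _ (mul_pos_of_neg_of_neg (sub_neg.2 (hx h)) (sub_neg.2 (hy h)))
  have h4 : ∑ i, ∑ j, f i j * ((x i - x j) - (y i - y j))
      = ∑ i, ∑ j, f i j * (x i - y i) - ∑ i, ∑ j, f i j * (x j - y j) := by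
    rw [← Finset.sum_sub_distrib]
    refine Finset.sum_congr rfl fun i _ => ?_
    rw [← Finset.sum_sub_distrib]
    exact Finset.sum_congr rfl fun j _ => by ring
  linarith

/-- The squared distance of two solutions is nonincreasing by monotonicity of the field. This
identifies the solution chosen in `flow` with any explicit one. -/
lemma IsFlowLine.unique {x : Fin N → ℝ} {u v : ℝ → Fin N → ℝ} (hu : IsFlowLine x u)
    (hv : IsFlowLine x v) {t : ℝ} (ht : 0 ≤ t) : u t = v t := by
  set g : ℝ → ℝ := fun s => ∑ i, (u s i - v s i) ^ 2 with hg
  have hd : ∀ s, 0 ≤ s → HasDerivWithinAt g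
      (∑ i, 2 * ((repulsion (u s) i - repulsion (v s) i) * (u s i - v s i))) (Set.Ici 0) s := by
    intro s hs
    refine HasDerivWithinAt.fun_sum fun i _ => ?_
    have h1 := hasDerivWithinAt_pi.1 (hu.deriv s hs) i
    have h2 := hasDerivWithinAt_pi.1 (hv.deriv s hs) i
    refine ((h1.sub h2).pow 2).congr_deriv ?_
    simp only [Pi.sub_apply]
    ring
  have hanti : AntitoneOn g (Set.Ici 0) := by
    refine antitoneOn_of_hasDerivWithinAt_nonpos (convex_Ici 0)
      (fun s hs => (hd s hs).continuousWithinAt)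
      (fun s hs => (hd s (interior_subset hs)).mono interior_subset) fun s hs => ?_
    rw [← Finset.mul_sum]
    have := sum_repulsion_sub_mul_sub_nonpos
      (strictAnti_of_mem_interior (hu.mem s (interior_subset hs)))
      (strictAnti_of_mem_interior (hv.mem s (interior_subset hs)))
    linarith
  have h0 : g 0 = 0 := by simp [hg, hu.start, hv.start]
  have h1 : g t ≤ 0 := h0 ▸ hanti (Set.mem_Ici.2 le_rfl) (Set.mem_Ici.2 ht) ht
  have h2 := (Finset.sum_eq_zero_iff_of_nonneg fun i _ => sq_nonneg (u t i - v t i)).1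
    (le_antisymm h1 (Finset.sum_nonneg fun i _ => sq_nonneg _))
  funext i
  have := h2 i (Finset.mem_univ i)
  exact sub_eq_zero.1 (pow_eq_zero_iff (two_ne_zero) |>.1 this)

/-- On the ray, `H (ρ z) = ρ⁻¹ z`, so the flow reduces to the scalar equation `ρ' = 1 / ρ`. -/
lemma isFlowLine_smul_hermiteZeros {z : Fin N → ℝ} (hz : IsHermiteZeros z) {a : ℝ} (ha : 0 < a) :
    IsFlowLine (a • z) fun t => √(2 * t + a ^ 2) • z where
  start := by simp [Real.sqrt_sq ha.le]
  mem t ht := by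
    refine mem_interior_of_strictAnti fun i j hij => ?_
    have : 0 < √(2 * t + a ^ 2) := Real.sqrt_pos.2 (by positivity)
    simpa using mul_lt_mul_of_pos_left (hz.1 hij) this
  deriv t ht := by
    have hpos : 2 * t + a ^ 2 ≠ 0 := by positivity
    have h1 : HasDerivAt (fun t : ℝ => √(2 * t + a ^ 2)) (√(2 * t + a ^ 2))⁻¹ t := by
      have := (((hasDerivAt_id t).const_mul 2).add_const (a ^ 2)).sqrt hpos
      refine this.congr_deriv ?_
      simp only [id, mul_one]
      field_simp
    rw [repulsion_smul, repulsion_hermiteZeros hz]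
    exact (h1.smul_const z).hasDerivWithinAt

lemma flow_smul_hermiteZeros {z : Fin N → ℝ} (hz : IsHermiteZeros z) {a t : ℝ} (ha : 0 < a)
    (ht : 0 ≤ t) : flow t (a • z) = √(2 * t + a ^ 2) • z := by
  have h : ∃ u, IsFlowLine (a • z) u := ⟨_, isFlowLine_smul_hermiteZeros hz ha⟩
  rw [flow, dif_pos h]
  exact h.choose_spec.unique (isFlowLine_smul_hermiteZeros hz ha) ht

/-- The function `c ^ 2 + (exp (2 lam t) - 1) / lam`. -/
noncomputable def growth (lam c t : ℝ) : ℝ := c ^ 2 + (Real.exp (2 * lam * t) - 1) / lam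

lemma exp_sub_one_div_nonneg (lam : ℝ) {t : ℝ} (ht : 0 ≤ t) :
    0 ≤ (Real.exp (2 * lam * t) - 1) / lam := by
  rcases le_total 0 lam with h | h
  · exact div_nonneg (sub_nonneg.2 (Real.one_le_exp (by positivity))) h
  · refine div_nonneg_of_nonpos (sub_nonpos.2 (Real.exp_le_one_iff.2 ?_)) h
    nlinarith

lemma growth_pos (lam : ℝ) {c t : ℝ} (hc : 0 < c) (ht : 0 ≤ t) : 0 < growth lam c t := by
  have := exp_sub_one_div_nonneg lam ht
  unfold growth
  positivity

/-- The radial part `√(c ^ 2 exp (-2 lam t) + (1 - exp (-2 lam t)) / lam)` of the limit flow. -/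
noncomputable def radius (lam c t : ℝ) : ℝ := √(Real.exp (-2 * lam * t) * growth lam c t)

lemma radius_pos (lam : ℝ) {c t : ℝ} (hc : 0 < c) (ht : 0 ≤ t) : 0 < radius lam c t :=
  Real.sqrt_pos.2 (mul_pos (Real.exp_pos _) (growth_pos lam hc ht))

lemma radius_sq (lam : ℝ) {c t : ℝ} (hc : 0 < c) (ht : 0 ≤ t) :
    radius lam c t ^ 2 = Real.exp (-2 * lam * t) * growth lam c t :=
  Real.sq_sqrt (mul_pos (Real.exp_pos _) (growth_pos lam hc ht)).le

@[fun_prop]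
lemma continuous_growth (lam c : ℝ) : Continuous (growth lam c) := by
  unfold growth; fun_prop

@[fun_prop]
lemma continuous_radius (lam c : ℝ) : Continuous (radius lam c) := by
  unfold radius; fun_prop

lemma radius_zero {lam c : ℝ} (hc : 0 < c) : radius lam c 0 = c := by
  simp [radius, growth, Real.sqrt_sq hc.le]

/-- The time change `s` is nonnegative for either sign of `lam`, and `2 s + (exp (-lam t) c) ^ 2`
equals `exp (-2 lam t) * growth lam c t`. -/
lemma flowOU_smul_hermiteZeros {z : Fin N → ℝ} (hz : IsHermiteZeros z) {lam c t : ℝ}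
    (hlam : lam ≠ 0) (hc : 0 < c) (ht : 0 ≤ t) :
    flowOU lam (c • z) t = radius lam c t • z := by
  have hs : 0 ≤ (1 - Real.exp (-2 * lam * t)) / (2 * lam) := by
    have h := exp_sub_one_div_nonneg (-lam) ht
    have h2 : (1 - Real.exp (-2 * lam * t)) / (2 * lam)
      = (Real.exp (2 * -lam * t) - 1) / -lam / 2 := by
      rw [show 2 * -lam * t = -2 * lam * t by ring]
      field_simp
      ring
    rw [h2]
    positivity
  rw [flowOU, smul_smul, flow_smul_hermiteZeros hz (by positivity) hs, radius, growth]
  congr 2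
  have h3 : Real.exp (-2 * lam * t) * Real.exp (2 * lam * t) = 1 := by
    rw [← Real.exp_add]; simp
  rw [mul_pow, ← Real.exp_nat_mul]
  rw [show ((2 : ℕ) : ℝ) * (-lam * t) = -2 * lam * t by push_cast; ring]
  rw [show -2 * lam * t = -(2 * lam * t) by ring] at h3 ⊢
  field_simp
  linear_combination -h3

lemma hasDerivAt_growth {lam : ℝ} (hlam : lam ≠ 0) (c t : ℝ) :
    HasDerivAt (growth lam c) (2 * Real.exp (2 * lam * t)) t := by
  have h1 : HasDerivAt (fun t : ℝ => Real.exp (2 * lam * t)) (Real.exp (2 * lam * t) * (2 * lam)) t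
      := by
    simpa using ((hasDerivAt_id t).const_mul (2 * lam)).exp
  have h2 := ((h1.sub_const 1).div_const lam).const_add (c ^ 2)
  refine h2.congr_deriv ?_
  field_simp

lemma hasDerivAt_radius {lam c t : ℝ} (hlam : lam ≠ 0) (hc : 0 < c) (ht : 0 ≤ t) :
    HasDerivAt (radius lam c) ((radius lam c t)⁻¹ - lam * radius lam c t) t := by
  have hpos := mul_pos (Real.exp_pos (-2 * lam * t)) (growth_pos lam hc ht)
  have hr := radius_pos lam hc ht
  have hsq := radius_sq lam hc ht
  have h1 : HasDerivAt (fun t : ℝ => Real.exp (-2 * lam * t))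
      (Real.exp (-2 * lam * t) * (-2 * lam)) t := by
    simpa using ((hasDerivAt_id t).const_mul (-2 * lam)).exp
  have h2 := (h1.mul (hasDerivAt_growth hlam c t)).sqrt hpos.ne'
  have h3 : Real.exp (-2 * lam * t) * Real.exp (2 * lam * t) = 1 := by
    rw [← Real.exp_add]; simp
  refine h2.congr_deriv ?_
  change _ / (2 * radius lam c t) = _
  rw [show -2 * lam * t = -(2 * lam * t) by ring] at h3 hsq ⊢
  field_simp
  linear_combination lam * hsq + h3

end BesselOU

/-! ### Linearization of the repulsion field, and Gronwall's inequality -/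

namespace BesselOU

variable {N : ℕ}

lemma interactionMatrix_mulVec_apply (p h : Fin N → ℝ) (i : Fin N) :
    (interactionMatrix p).mulVec h i
      = ∑ j ∈ Finset.univ.erase i, (h j - h i) / (p i - p j) ^ 2 := by
  rw [Matrix.mulVec, dotProduct, ← Finset.add_sum_erase _ _ (Finset.mem_univ i)]
  simp only [interactionMatrix, Matrix.of_apply, if_true]
  rw [neg_mul, Finset.sum_mul, ← Finset.sum_neg_distrib, ← Finset.sum_add_distrib]
  refine Finset.sum_congr rfl fun j hj => ?_
  rw [if_neg (Finset.ne_of_mem_erase hj).symm]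
  ring

lemma abs_sum_erase_le {f : Fin N → ℝ} {i : Fin N} {C : ℝ} (hC : 0 ≤ C)
    (hf : ∀ j, i ≠ j → |f j| ≤ C) : |∑ j ∈ Finset.univ.erase i, f j| ≤ N * C := by
  refine (Finset.abs_sum_le_sum_abs _ _).trans ?_
  refine (Finset.sum_le_card_nsmul _ _ C fun j hj => hf j (Finset.ne_of_mem_erase hj).symm).trans ?_
  rw [nsmul_eq_mul]
  gcongr
  simp

lemma abs_one_div_sub_one_div_le {a b d m : ℝ} (hd : 0 < d) (ha : d ≤ |a|) (hb : d / 2 ≤ |b|)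
    (hm : |a - b| ≤ 2 * m) : |1 / b - 1 / a| ≤ 4 / d ^ 2 * m := by
  have ha0 : a ≠ 0 := abs_pos.1 (hd.trans_le ha)
  have hb0 : b ≠ 0 := abs_pos.1 ((half_pos hd).trans_le hb)
  have h1 : 1 / b - 1 / a = (a - b) / (a * b) := by field_simp
  rw [h1, abs_div, abs_mul]
  calc |a - b| / (|a| * |b|) ≤ 2 * m / (d * (d / 2)) := by
        gcongr
        exact (abs_nonneg _).trans hm
    _ = 4 / d ^ 2 * m := by field_simp; ring

/-- The remainder is exactly `(a - b) ^ 2 / (a ^ 2 * b)`. The weaker bound `d / 2` is for `b`, the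
gap of the perturbed vector. -/
lemma abs_one_div_sub_one_div_sub_le {a b d m : ℝ} (hd : 0 < d) (ha : d ≤ |a|) (hb : d / 2 ≤ |b|)
    (hm : |a - b| ≤ 2 * m) : |1 / b - 1 / a - (a - b) / a ^ 2| ≤ 8 / d ^ 3 * m ^ 2 := by
  have ha0 : a ≠ 0 := abs_pos.1 (hd.trans_le ha)
  have hb0 : b ≠ 0 := abs_pos.1 ((half_pos hd).trans_le hb)
  have h1 : 1 / b - 1 / a - (a - b) / a ^ 2 = (a - b) ^ 2 / (a ^ 2 * b) := by field_simp
  rw [h1, abs_div, abs_mul, abs_pow, abs_pow]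
  calc |a - b| ^ 2 / (|a| ^ 2 * |b|) ≤ (2 * m) ^ 2 / (d ^ 2 * (d / 2)) := by gcongr
    _ = 8 / d ^ 3 * m ^ 2 := by field_simp; ring

section Tube

variable {d : ℝ} {x p : Fin N → ℝ}

lemma abs_sub_sub_sub_le (x p : Fin N → ℝ) (i j : Fin N) :
    |(p i - p j) - (x i - x j)| ≤ 2 * ‖x - p‖ := by
  have hi := norm_le_pi_norm (x - p) i
  have hj := norm_le_pi_norm (x - p) j
  rw [Pi.sub_apply, Real.norm_eq_abs, abs_le] at hi hj
  rw [abs_le]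
  constructor <;> linarith

/-- A gap moves by at most `2 * ‖x - p‖ ≤ d / 2`; this fixes the tube radius `d / 4` used below. -/
lemma half_le_abs_sub (hp : ∀ i j, i ≠ j → d ≤ |p i - p j|) (hx : ‖x - p‖ ≤ d / 4)
    {i j : Fin N} (hij : i ≠ j) : d / 2 ≤ |x i - x j| := by
  have h1 := hp i j hij
  have h2 := abs_sub_sub_sub_le x p i j
  have h3 := abs_sub_abs_le_abs_sub (p i - p j) (x i - x j)
  linarith

/-- The repulsion field is Lipschitz near a vector with separated entries. -/
lemma abs_repulsion_sub_le (hd : 0 < d) (hp : ∀ i j, i ≠ j → d ≤ |p i - p j|)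
    (hx : ‖x - p‖ ≤ d / 4) (i : Fin N) :
    |repulsion x i - repulsion p i| ≤ N * (4 / d ^ 2 * ‖x - p‖) := by
  rw [repulsion, repulsion, ← Finset.sum_sub_distrib]
  exact abs_sum_erase_le (by positivity) fun j hij => abs_one_div_sub_one_div_le hd (hp i j hij)
    (half_le_abs_sub hp hx hij) (abs_sub_sub_sub_le x p i j)

/-- The interaction matrix is the derivative of the repulsion field, with a quadratic bound for the
remainder. -/
lemma abs_repulsion_sub_sub_le (hd : 0 < d) (hp : ∀ i j, i ≠ j → d ≤ |p i - p j|)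
    (hx : ‖x - p‖ ≤ d / 4) (i : Fin N) :
    |repulsion x i - repulsion p i - (interactionMatrix p).mulVec (x - p) i|
      ≤ N * (8 / d ^ 3 * ‖x - p‖ ^ 2) := by
  rw [repulsion, repulsion, interactionMatrix_mulVec_apply, ← Finset.sum_sub_distrib,
    ← Finset.sum_sub_distrib]
  refine abs_sum_erase_le (by positivity) fun j hij => ?_
  have := abs_one_div_sub_one_div_sub_le hd (hp i j hij)
    (half_le_abs_sub hp hx hij) (abs_sub_sub_sub_le x p i j)
  convert this using 4
  simp only [Pi.sub_apply]
  ring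

lemma abs_interactionMatrix_mulVec_le (hd : 0 < d) (hp : ∀ i j, i ≠ j → d ≤ |p i - p j|)
    (h : Fin N → ℝ) (i : Fin N) :
    |(interactionMatrix p).mulVec h i| ≤ N * (4 / d ^ 2 * ‖h‖) := by
  rw [interactionMatrix_mulVec_apply]
  refine abs_sum_erase_le (by positivity) fun j hij => ?_
  have hi := norm_le_pi_norm h i
  have hj := norm_le_pi_norm h j
  rw [Real.norm_eq_abs] at hi hj
  have hij' := hp i j hij
  rw [abs_div, abs_pow]
  calc |h j - h i| / |p i - p j| ^ 2 ≤ (4 * ‖h‖) / d ^ 2 := by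
        gcongr
        have := abs_sub (h j) (h i)
        have := norm_nonneg h
        linarith
    _ = 4 / d ^ 2 * ‖h‖ := by ring

end Tube

/-- Gronwall's inequality in integral form. -/
lemma le_mul_exp_of_le_add_mul_integral {u : ℝ → ℝ} (hu : Continuous u) {a K T : ℝ} (hK : 0 ≤ K)
    (h : ∀ t ∈ Set.Icc 0 T, u t ≤ a + K * ∫ s in (0 : ℝ)..t, u s) {t : ℝ}
    (ht : t ∈ Set.Icc 0 T) : u t ≤ a * Real.exp (K * t) := by
  set v : ℝ → ℝ := fun t => a + K * ∫ s in (0 : ℝ)..t, u s with hv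
  have hd : ∀ s, HasDerivAt v (K * u s) s := fun s =>
    ((hu.integral_hasStrictDerivAt 0 s).hasDerivAt.const_mul K).const_add a
  have hw : ∀ s, HasDerivAt (fun s => v s * Real.exp (-(K * s)))
      ((K * (u s - v s)) * Real.exp (-(K * s))) s := by
    intro s
    have he : HasDerivAt (fun s : ℝ => Real.exp (-(K * s))) (Real.exp (-(K * s)) * -K) s := by
      simpa using ((hasDerivAt_id s).const_mul K).neg.exp
    exact ((hd s).mul he).congr_deriv (by ring)
  have hanti : AntitoneOn (fun s => v s * Real.exp (-(K * s))) (Set.Icc 0 T) := by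
    refine antitoneOn_of_hasDerivWithinAt_nonpos (convex_Icc 0 T)
      (fun s _ => (hw s).continuousAt.continuousWithinAt)
      (fun s _ => (hw s).hasDerivWithinAt) fun s hs => ?_
    have := h s (interior_subset hs)
    exact mul_nonpos_of_nonpos_of_nonneg
      (mul_nonpos_of_nonneg_of_nonpos hK (sub_nonpos.2 this)) (Real.exp_pos _).le
  have h0 := hanti (Set.left_mem_Icc.2 (ht.1.trans ht.2)) ht ht.1
  simp only [hv, intervalIntegral.integral_same, mul_zero, add_zero, neg_zero, Real.exp_zero,
    mul_one] at h0
  calc u t ≤ v t := h t ht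
    _ = v t * Real.exp (-(K * t)) * Real.exp (K * t) := by
      rw [mul_assoc, ← Real.exp_add]; simp
    _ ≤ a * Real.exp (K * t) := by
      gcongr

lemma le_mul_exp_bound {u : ℝ → ℝ} (hu : Continuous u) {a K T : ℝ} (hK : 0 ≤ K) (ha : 0 ≤ a)
    (h : ∀ t ∈ Set.Icc 0 T, u t ≤ a + K * ∫ s in (0 : ℝ)..t, u s) {t S : ℝ}
    (ht : t ∈ Set.Icc 0 T) (hS : t ≤ S) : u t ≤ a * Real.exp (K * S) :=
  (le_mul_exp_of_le_add_mul_integral hu hK h ht).trans (by gcongr)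

lemma exists_separation {z : Fin N → ℝ} (hz : StrictAnti z) {r : ℝ → ℝ} (hr : Continuous r)
    {T : ℝ} (hpos : ∀ t ∈ Set.Icc 0 T, 0 < r t) :
    ∃ d, 0 < d ∧ ∀ t ∈ Set.Icc 0 T, ∀ i j, i ≠ j → d ≤ |(r t • z) i - (r t • z) j| := by
  obtain ⟨ρ, hρ, hρr⟩ : ∃ ρ, 0 < ρ ∧ ∀ t ∈ Set.Icc 0 T, ρ ≤ r t := by
    exact isCompact_Icc.exists_forall_le' hr.continuousOn hpos
  obtain ⟨e, he, hez⟩ : ∃ e, 0 < e ∧ ∀ q : Fin N × Fin N, q.1 ≠ q.2 → e ≤ |z q.1 - z q.2| := by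
    refine (Set.toFinite {q : Fin N × Fin N | q.1 ≠ q.2}).isCompact.exists_forall_le'
      continuous_of_discreteTopology.continuousOn fun q hq => ?_
    exact abs_pos.2 (sub_ne_zero.2 (hz.injective.ne hq))
  refine ⟨ρ * e, by positivity, fun t ht i j hij => ?_⟩
  have h1 := hρr t ht
  rw [Pi.smul_apply, Pi.smul_apply, smul_eq_mul, smul_eq_mul, ← mul_sub, abs_mul]
  exact mul_le_mul (h1.trans (le_abs_self _)) (hez (i, j) hij) he.le (abs_nonneg _)


/-! ### A priori bound and linear approximation for rescaled deviations -/

section Paths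

variable {D w p β : ℝ → Fin N → ℝ} {lam κ d T M K : ℝ}

/-- The drift of the rescaled deviation `D = κ (x - p)` of a path `x` from the limit `p`. -/
noncomputable def deviationDrift (lam κ : ℝ) (p v : Fin N → ℝ) : Fin N → ℝ :=
  fun i => κ * (repulsion (p + κ⁻¹ • v) i - repulsion p i) - lam * v i

lemma abs_deviationDrift_le {p v : Fin N → ℝ} (hκ : 0 < κ) (hd : 0 < d)
    (hp : ∀ i j, i ≠ j → d ≤ |p i - p j|) (hv : ‖v‖ ≤ κ * (d / 4)) (i : Fin N) :
    |deviationDrift lam κ p v i| ≤ (N * (4 / d ^ 2) + |lam|) * ‖v‖ := by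
  have hn : ‖p + κ⁻¹ • v - p‖ = κ⁻¹ * ‖v‖ := by
    rw [add_sub_cancel_left, norm_smul, Real.norm_of_nonneg (inv_nonneg.2 hκ.le)]
  have h1 := abs_repulsion_sub_le hd hp (x := p + κ⁻¹ • v)
    (by rw [hn, inv_mul_le_iff₀ hκ]; exact hv) i
  have h2 := norm_le_pi_norm v i
  rw [hn] at h1
  rw [Real.norm_eq_abs] at h2
  calc |deviationDrift lam κ p v i|
      ≤ κ * |repulsion (p + κ⁻¹ • v) i - repulsion p i| + |lam| * |v i| := by
        rw [deviationDrift, ← abs_mul lam, ← abs_of_pos hκ, ← abs_mul, abs_of_pos hκ]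
        exact abs_sub _ _
    _ ≤ κ * (N * (4 / d ^ 2 * (κ⁻¹ * ‖v‖))) + |lam| * ‖v‖ := by gcongr
    _ = (N * (4 / d ^ 2) + |lam|) * ‖v‖ := by field_simp

lemma abs_deviationDrift_sub_le {p v w : Fin N → ℝ} (hκ : 0 < κ) (hd : 0 < d)
    (hp : ∀ i j, i ≠ j → d ≤ |p i - p j|) (hv : ‖v‖ ≤ κ * (d / 4)) (i : Fin N) :
    |deviationDrift lam κ p v i - (interactionMatrix p - lam • 1).mulVec w i|
      ≤ N * (8 / d ^ 3) * ‖v‖ ^ 2 / κ + (N * (4 / d ^ 2) + |lam|) * ‖v - w‖ := by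
  have hn : ‖p + κ⁻¹ • v - p‖ = κ⁻¹ * ‖v‖ := by
    rw [add_sub_cancel_left, norm_smul, Real.norm_of_nonneg (inv_nonneg.2 hκ.le)]
  have h1 := abs_repulsion_sub_sub_le hd hp (x := p + κ⁻¹ • v)
    (by rw [hn, inv_mul_le_iff₀ hκ]; exact hv) i
  have h2 := norm_le_pi_norm (v - w) i
  have h3 := abs_interactionMatrix_mulVec_le hd hp (v - w) i
  rw [hn, add_sub_cancel_left, Matrix.mulVec_smul, Pi.smul_apply, smul_eq_mul] at h1
  rw [Real.norm_eq_abs] at h2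
  have heq : deviationDrift lam κ p v i - (interactionMatrix p - lam • 1).mulVec w i
      = κ * (repulsion (p + κ⁻¹ • v) i - repulsion p i
          - κ⁻¹ * (interactionMatrix p).mulVec v i)
        + (interactionMatrix p).mulVec (v - w) i - lam * (v - w) i := by
    rw [deviationDrift, Matrix.sub_mulVec, Matrix.smul_mulVec, Matrix.one_mulVec,
      Matrix.mulVec_sub]
    simp only [Pi.sub_apply, Pi.smul_apply, smul_eq_mul]
    field_simp
    ring
  rw [heq]
  refine (abs_sub _ _).trans ((add_le_add_left (abs_add_le _ _) _).trans ?_)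
  rw [abs_mul, abs_mul, abs_of_pos hκ]
  calc _ ≤ κ * (N * (8 / d ^ 3 * (κ⁻¹ * ‖v‖) ^ 2)) + N * (4 / d ^ 2 * ‖v - w‖)
        + |lam| * ‖v - w‖ := by gcongr
    _ = _ := by field_simp; ring

/-- The bound on `f` is needed only before `t`, the endpoint being null: up to an exit time the path
is controlled only strictly before it. -/
lemma norm_le_add_integral (hM : 0 ≤ M) {t : ℝ} (ht : 0 ≤ t) {v : Fin N → ℝ}
    {β : Fin N → ℝ} {f : ℝ → Fin N → ℝ} {g : ℝ → ℝ} (hg : Continuous g) (hg0 : ∀ s, 0 ≤ g s)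
    (hv : ∀ i, v i = β i + ∫ s in (0 : ℝ)..t, f s i) (hβ : ‖β‖ ≤ M)
    (hfg : ∀ s ∈ Set.Ico 0 t, ∀ i, |f s i| ≤ g s) : ‖v‖ ≤ M + ∫ s in (0 : ℝ)..t, g s := by
  have hint : 0 ≤ ∫ s in (0 : ℝ)..t, g s := intervalIntegral.integral_nonneg ht fun s _ => hg0 s
  refine (pi_norm_le_iff_of_nonneg (by positivity)).2 fun i => ?_
  rw [hv i]
  refine (norm_add_le _ _).trans (add_le_add ((norm_le_pi_norm β i).trans hβ) ?_)
  refine intervalIntegral.norm_integral_le_of_norm_le ht ?_ (hg.intervalIntegrable _ _)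
  filter_upwards [compl_mem_ae_iff.2 (measure_singleton t)] with s hs hst
  exact hfg s ⟨hst.1.le, lt_of_le_of_ne hst.2 hs⟩ i

/-- A rescaled deviation stays bounded, uniformly in the scale. -/
lemma norm_deviation_le (hD : Continuous D) (hκ : 0 < κ) (hd : 0 < d)
    (hp : ∀ t ∈ Set.Icc 0 T, ∀ i j, i ≠ j → d ≤ |p t i - p t j|)
    (hDeq : ∀ t ∈ Set.Icc 0 T, ∀ i,
      D t i = β t i + ∫ s in (0 : ℝ)..t, deviationDrift lam κ (p s) (D s) i)
    (hM : 0 ≤ M) (hβ : ∀ t ∈ Set.Icc 0 T, ‖β t‖ ≤ M)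
    (hK : K = N * (4 / d ^ 2) + |lam|) (hC : M * Real.exp (K * T) < κ * (d / 4)) :
    ∀ t ∈ Set.Icc 0 T, ‖D t‖ ≤ M * Real.exp (K * T) := by
  have hK0 : 0 ≤ K := by rw [hK]; positivity
  -- Bootstrap: inside the tube the drift is at most `K * ‖D‖`, so Gronwall applies.
  have key : ∀ t ∈ Set.Icc 0 T, (∀ s ∈ Set.Ico 0 t, ‖D s‖ ≤ κ * (d / 4)) →
      ‖D t‖ ≤ M * Real.exp (K * T) := by
    intro t ht htube
    refine le_mul_exp_bound hD.norm hK0 hM (fun u hu => ?_) (Set.right_mem_Icc.2 ht.1) ht.2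
    have huT : u ∈ Set.Icc 0 T := ⟨hu.1, hu.2.trans ht.2⟩
    rw [← intervalIntegral.integral_const_mul]
    refine norm_le_add_integral hM hu.1 (hD.norm.const_mul K)
      (fun s => mul_nonneg hK0 (norm_nonneg _)) (hDeq u huT) (hβ u huT) fun s hs i => ?_
    rw [hK]
    exact abs_deviationDrift_le hκ hd (hp s ⟨hs.1, hs.2.le.trans huT.2⟩)
      (htube s ⟨hs.1, hs.2.trans_le hu.2⟩) i
  by_contra! hcon
  obtain ⟨t₁, ht₁, hlt⟩ := hcon
  have hexit : (Set.Icc 0 T ∩ {s | κ * (d / 4) ≤ ‖D s‖}).Nonempty := by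
    by_contra! hempty
    refine absurd (key t₁ ht₁ fun s hs => ?_) (not_le.2 hlt)
    by_contra! hs'
    exact (Set.eq_empty_iff_forall_notMem.1 hempty) s ⟨⟨hs.1, hs.2.le.trans ht₁.2⟩, hs'.le⟩
  -- At the first exit time the norm is at least `κ * (d / 4)`, while Gronwall and `hC` make it
  -- strictly smaller.
  obtain ⟨t₀, ht₀, hleast⟩ := (isCompact_Icc.inter_right
    (isClosed_le continuous_const hD.norm)).exists_isLeast hexit
  have h1 := key t₀ ht₀.1 fun s hs => by
    by_contra! hs'
    exact absurd (hleast ⟨⟨hs.1, hs.2.le.trans ht₀.1.2⟩, hs'.le⟩) (not_le.2 hs.2)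
  have h2 : κ * (d / 4) ≤ ‖D t₀‖ := ht₀.2
  linarith

/-- A rescaled deviation is close to the solution of the linearized equation. -/
lemma norm_deviation_sub_le (hD : Continuous D) (hw : Continuous w) (hκ : 0 < κ) (hd : 0 < d)
    (hp : ∀ t ∈ Set.Icc 0 T, ∀ i j, i ≠ j → d ≤ |p t i - p t j|)
    (hDint : ∀ t ∈ Set.Icc 0 T, ∀ i, IntervalIntegrable
      (fun s => deviationDrift lam κ (p s) (D s) i) volume 0 t)
    (hDeq : ∀ t ∈ Set.Icc 0 T, ∀ i,
      D t i = β t i + ∫ s in (0 : ℝ)..t, deviationDrift lam κ (p s) (D s) i)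
    (hwint : ∀ t ∈ Set.Icc 0 T, ∀ i, IntervalIntegrable
      (fun s => (interactionMatrix (p s) - lam • 1).mulVec (w s) i) volume 0 t)
    (hweq : ∀ t ∈ Set.Icc 0 T, ∀ i,
      w t i = β t i + ∫ s in (0 : ℝ)..t, (interactionMatrix (p s) - lam • 1).mulVec (w s) i)
    (hM : 0 ≤ M) (hβ : ∀ t ∈ Set.Icc 0 T, ‖β t‖ ≤ M)
    (hK : K = N * (4 / d ^ 2) + |lam|) (hC : M * Real.exp (K * T) < κ * (d / 4)) :
    ∀ t ∈ Set.Icc 0 T, ‖D t - w t‖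
      ≤ T * (N * (8 / d ^ 3) * (M * Real.exp (K * T)) ^ 2 / κ) * Real.exp (K * T) := by
  intro t ht
  have hbound := norm_deviation_le hD hκ hd hp hDeq hM hβ hK hC
  have hK0 : 0 ≤ K := by rw [hK]; positivity
  -- The quadratic Taylor remainder under the a priori bound on `D`; it is of order `1 / κ`.
  set R := N * (8 / d ^ 3) * (M * Real.exp (K * T)) ^ 2 / κ with hR
  have hR0 : 0 ≤ R := by positivity
  have hT : 0 ≤ T := ht.1.trans ht.2
  refine le_mul_exp_bound (hD.sub hw).norm hK0 (mul_nonneg hT hR0) (fun u hu => ?_) ht ht.2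
  -- Both equations have the same `β`, so start and noise cancel in the difference.
  have h1 : ‖D u - w u‖ ≤ 0 + ∫ s in (0 : ℝ)..u, (R + K * ‖D s - w s‖) := by
    refine norm_le_add_integral (β := 0) (f := fun s i => deviationDrift lam κ (p s) (D s) i
        - (interactionMatrix (p s) - lam • 1).mulVec (w s) i) le_rfl hu.1 (by fun_prop)
      (fun s => by positivity) (fun i => ?_) (by simp) fun s hs i => ?_
    · rw [intervalIntegral.integral_sub (hDint u hu i) (hwint u hu i), Pi.sub_apply, hDeq u hu i,
        hweq u hu i]
      simp
    · have hsT : s ∈ Set.Icc 0 T := ⟨hs.1, hs.2.le.trans hu.2⟩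
      refine (abs_deviationDrift_sub_le hκ hd (hp s hsT) ((hbound s hsT).trans hC.le) i).trans ?_
      rw [hR, ← hK]
      gcongr
      exact hbound s hsT
  rw [intervalIntegral.integral_add (by simp)
    ((by fun_prop : Continuous fun s => K * ‖D s - w s‖).intervalIntegrable _ _),
    intervalIntegral.integral_const_mul, intervalIntegral.integral_const, sub_zero, smul_eq_mul,
    zero_add] at h1
  exact h1.trans (add_le_add (mul_le_mul_of_nonneg_right hu.2 hR0) le_rfl)

end Paths

end BesselOU

/-! ### From Bessel paths to deviations: pathwise convergence -/

namespace BesselOU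

variable {N : ℕ}

lemma interactionMatrix_smul (a : ℝ) (x : Fin N → ℝ) :
    interactionMatrix (a • x) = (a ^ 2)⁻¹ • interactionMatrix x := by
  have h : ∀ i j, 1 / ((a • x) i - (a • x) j) ^ 2 = (a ^ 2)⁻¹ * (1 / (x i - x j) ^ 2) := by
    intro i j
    rw [Pi.smul_apply, Pi.smul_apply, smul_eq_mul, smul_eq_mul, ← mul_sub, mul_pow, one_div,
      mul_inv, one_div]
  ext i j
  simp only [interactionMatrix, Matrix.of_apply, Matrix.smul_apply, smul_eq_mul, h, mul_ite,
    mul_neg, Finset.mul_sum]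

variable {z : Fin N → ℝ} {lam c : ℝ}

lemma driftMatrix_smul_hermiteZeros (hz : IsHermiteZeros z) (hlam : lam ≠ 0) (hc : 0 < c) {t : ℝ}
    (ht : 0 ≤ t) : driftMatrix lam (c • z) t
      = (radius lam c t ^ 2)⁻¹ • interactionMatrix z - lam • 1 := by
  rw [driftMatrix, flowOU_smul_hermiteZeros hz hlam hc ht, interactionMatrix_smul]

lemma continuousOn_inv_radius (hc : 0 < c) : ContinuousOn (fun t => (radius lam c t)⁻¹)
    (Set.Ici 0) :=
  (continuous_radius lam c).continuousOn.inv₀ fun _ ht => (radius_pos lam hc ht).ne'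

lemma Icc_zero_subset_Ici {t : ℝ} (ht : 0 ≤ t) : Set.uIcc 0 t ⊆ Set.Ici 0 := by
  rw [Set.uIcc_of_le ht]
  exact Set.Icc_subset_Ici_self

/-- The equation for the rescaled deviation of a Bessel path from the deterministic limit. -/
lemma deviation_eq (hz : IsHermiteZeros z) (hlam : lam ≠ 0) (hc : 0 < c) {k : ℝ} (hk : 0 < k)
    {y : Fin N → ℝ} {b q : ℝ≥0 → Fin N → ℝ} {t : ℝ≥0} {i : Fin N}
    (hint : IntervalIntegrable (fun s : ℝ => besselDrift lam k (q s.toNNReal) i) volume 0 t)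
    (heq : q t i = (√k • c • z + y) i + b t i
      + ∫ s in (0 : ℝ)..t, besselDrift lam k (q s.toNNReal) i)
    {D : ℝ → Fin N → ℝ} (hD : D = fun s => √k • ((√k)⁻¹ • q s.toNNReal - radius lam c s • z)) :
    IntervalIntegrable (fun s => deviationDrift lam (√k) (radius lam c s • z) (D s) i) volume 0 t ∧
      D t i = (y + b t) i
        + ∫ s in (0 : ℝ)..t, deviationDrift lam (√k) (radius lam c s • z) (D s) i := by
  have hκ : 0 < √k := Real.sqrt_pos.2 hk
  have hκk : √k * √k = k := Real.mul_self_sqrt hk.le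
  -- Homogeneity turns `√k * repulsion ((√k)⁻¹ • q)` into `k * repulsion q`; the subtracted term is
  -- `√k * z i` times the derivative of `radius`.
  have hpt : ∀ s, deviationDrift lam (√k) (radius lam c s • z) (D s) i
      = besselDrift lam k (q s.toNNReal) i
        - √k * z i * ((radius lam c s)⁻¹ - lam * radius lam c s) := by
    intro s
    have h1 : radius lam c s • z + (√k)⁻¹ • D s = (√k)⁻¹ • q s.toNNReal := by
      rw [hD, smul_smul, inv_mul_cancel₀ hκ.ne', one_smul, add_sub_cancel]
    rw [deviationDrift, h1, repulsion_smul, repulsion_smul, repulsion_hermiteZeros hz, inv_inv,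
      besselDrift, hD]
    simp only [Pi.smul_apply, Pi.sub_apply, smul_eq_mul]
    have hinv : √k * (√k)⁻¹ = 1 := mul_inv_cancel₀ hκ.ne'
    linear_combination repulsion (q s.toNNReal) i * hκk - lam * q s.toNNReal i * hinv
  have hcont : ContinuousOn (fun s => √k * z i * ((radius lam c s)⁻¹ - lam * radius lam c s))
      (Set.Ici 0) :=
    continuousOn_const.mul ((continuousOn_inv_radius hc).sub (by fun_prop))
  have hint2 := (hcont.mono (Icc_zero_subset_Ici t.2)).intervalIntegrable (μ := volume)
  have hval : ∫ s in (0 : ℝ)..t, √k * z i * ((radius lam c s)⁻¹ - lam * radius lam c s)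
      = √k * z i * radius lam c t - √k * z i * radius lam c 0 := by
    refine intervalIntegral.integral_eq_sub_of_hasDerivAt
      (f := fun s => √k * z i * radius lam c s) (fun s hs => ?_) hint2
    exact (hasDerivAt_radius hlam hc (Icc_zero_subset_Ici t.2 hs)).const_mul _
  simp_rw [hpt]
  refine ⟨hint.sub hint2, ?_⟩
  rw [intervalIntegral.integral_sub hint hint2]
  have hval' := hval
  have heq' := heq
  rw [radius_zero hc] at hval'
  rw [hD]
  simp only [Pi.smul_apply, Pi.sub_apply, Pi.add_apply, smul_eq_mul, Real.toNNReal_coe] at heq' ⊢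
  have hcancel : √k * ((√k)⁻¹ * q t i - radius lam c t * z i)
      = q t i - √k * z i * radius lam c t := by
    field_simp
  rw [hcancel]
  linarith

lemma continuousOn_linearDrift (hc : 0 < c) {w : ℝ → Fin N → ℝ} (hw : Continuous w) (i : Fin N) :
    ContinuousOn (fun s => (interactionMatrix (radius lam c s • z) - lam • 1).mulVec (w s) i)
      (Set.Ici 0) := by
  have h1 : ∀ s, (interactionMatrix (radius lam c s • z) - lam • 1).mulVec (w s) i
      = (radius lam c s)⁻¹ ^ 2 * (interactionMatrix z).mulVec (w s) i - lam * w s i := by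
    intro s
    rw [interactionMatrix_smul, Matrix.sub_mulVec, Matrix.smul_mulVec, Matrix.smul_mulVec,
      Matrix.one_mulVec, inv_pow]
    rfl
  simp_rw [h1]
  have h2 : Continuous fun s => (interactionMatrix z).mulVec (w s) i :=
    (continuous_apply i).comp (Continuous.matrix_mulVec continuous_const hw)
  exact (((continuousOn_inv_radius hc).pow 2).mul h2.continuousOn).sub (by fun_prop)

/-- Pathwise form of the convergence of the rescaled deviations. -/
theorem tendstoLocallyUniformly_deviation (hz : IsHermiteZeros z) (hlam : lam ≠ 0) (hc : 0 < c)
    {y : Fin N → ℝ} {b w : ℝ≥0 → Fin N → ℝ} (hb : Continuous b) (hw : Continuous w)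
    (hweq : ∀ (t : ℝ≥0) i, w t i = y i + b t i
      + ∫ s in (0 : ℝ)..t, (driftMatrix lam (c • z) s).mulVec (w s.toNNReal) i)
    {k : ℕ → ℝ} (hk0 : ∀ n, 0 < k n) (hk : Tendsto k atTop atTop) {q : ℕ → ℝ≥0 → Fin N → ℝ}
    (hq : ∀ n, Continuous (q n))
    (hqeq : ∀ n (t : ℝ≥0) i,
      IntervalIntegrable (fun s : ℝ => besselDrift lam (k n) (q n s.toNNReal) i) volume 0 t ∧
      q n t i = (√(k n) • c • z + y) i + b t i
        + ∫ s in (0 : ℝ)..t, besselDrift lam (k n) (q n s.toNNReal) i) :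
    TendstoLocallyUniformly
      (fun n t => √(k n) • ((√(k n))⁻¹ • q n t - flowOU lam (c • z) t)) w atTop := by
  rw [tendstoLocallyUniformly_iff_forall_isCompact]
  intro S hS
  obtain ⟨T, hT⟩ := hS.bddAbove
  have hrad : ∀ t ∈ Set.Icc (0 : ℝ) T, 0 < radius lam c t := fun t ht => radius_pos lam hc ht.1
  obtain ⟨d, hd, hsep⟩ := exists_separation hz.1 (continuous_radius lam c) hrad
  -- The bound depends on the Brownian path but not on `n`, hence so do `K` and `C`.
  obtain ⟨M, hM⟩ := (isCompact_Icc (a := (0 : ℝ)) (b := T)).exists_bound_of_continuousOn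
    (f := fun s => y + b s.toNNReal) (by fun_prop)
  have hM0 : 0 ≤ M := (norm_nonneg _).trans (hM 0 ⟨le_rfl, T.2⟩)
  set K := N * (4 / d ^ 2) + |lam| with hK
  set C := M * Real.exp (K * T) with hC
  have hκ : Tendsto (fun n => √(k n)) atTop atTop := Real.tendsto_sqrt_atTop.comp hk
  have hsmall : Tendsto (fun n => T * (N * (8 / d ^ 3) * C ^ 2 / √(k n)) * Real.exp (K * T))
      atTop (nhds 0) := by
    have := ((hκ.const_div_atTop (N * (8 / d ^ 3) * C ^ 2)).const_mul (T : ℝ)).mul_const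
      (Real.exp (K * T))
    simpa using this
  rw [Metric.tendstoUniformlyOn_iff]
  intro ε hε
  have hlarge : ∀ᶠ n in atTop, C < √(k n) * (d / 4) :=
    (hκ.atTop_mul_const (by positivity : 0 < d / 4)).eventually_gt_atTop C
  filter_upwards [hlarge, hsmall.eventually_lt_const hε] with n hn hnε t ht
  set D : ℝ → Fin N → ℝ :=
    fun s => √(k n) • ((√(k n))⁻¹ • q n s.toNNReal - radius lam c s • z) with hD
  have hnonneg : ∀ s ∈ Set.Icc (0 : ℝ) T, ((s.toNNReal : ℝ≥0) : ℝ) = s := fun s hs =>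
    Real.coe_toNNReal s hs.1
  have hdev : ∀ s ∈ Set.Icc (0 : ℝ) T, ∀ i, _ := fun s hs i =>
    deviation_eq hz hlam hc (hk0 n) (hqeq n s.toNNReal i).1 (hqeq n s.toNNReal i).2 hD
  have hlin : ∀ s ∈ Set.Icc (0 : ℝ) T, ∀ i, w s.toNNReal i = (y + b s.toNNReal) i
      + ∫ u in (0 : ℝ)..s, (interactionMatrix (radius lam c u • z) - lam • 1).mulVec
        (w u.toNNReal) i := by
    intro s hs i
    rw [hweq, hnonneg s hs, Pi.add_apply]
    congr 1
    refine intervalIntegral.integral_congr fun u hu => ?_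
    have hu0 : 0 ≤ u := Icc_zero_subset_Ici hs.1 hu
    rw [driftMatrix, flowOU_smul_hermiteZeros hz hlam hc hu0]
  have hmain := norm_deviation_sub_le (D := D) (w := fun s => w s.toNNReal)
    (p := fun s => radius lam c s • z) (β := fun s => y + b s.toNNReal) (lam := lam)
    (κ := √(k n)) (d := d) (T := T) (M := M) (K := K)
    (by have := hq n; fun_prop) (by fun_prop) (Real.sqrt_pos.2 (hk0 n)) hd hsep
    (fun s hs i => by have := (hdev s hs i).1; rwa [hnonneg s hs] at this)
    (fun s hs i => by have := (hdev s hs i).2; rwa [hnonneg s hs] at this)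
    (fun s hs i => ((continuousOn_linearDrift hc (by fun_prop) i).mono
      (Icc_zero_subset_Ici hs.1)).intervalIntegrable) hlin hM0 hM hK hn t ⟨t.2, hT ht⟩
  rw [dist_comm, dist_eq_norm, flowOU_smul_hermiteZeros hz hlam hc t.coe_nonneg]
  simp only [hD, Real.toNNReal_coe] at hmain
  exact hmain.trans_lt hnε

end BesselOU

/-! ### Matrix exponentials, the adjoint flow and the variance integral -/

namespace BesselOU

section MatrixExponential

variable {m : Type*} [Fintype m] [DecidableEq m]

lemma hasDerivAt_matrix_exp_smul_mulVec (A : Matrix m m ℝ) (u : m → ℝ) (t : ℝ) :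
    HasDerivAt (fun s : ℝ => (NormedSpace.exp (s • A)).mulVec u)
      ((A * NormedSpace.exp (t • A)).mulVec u) t := by
  let _ : NormedRing (Matrix m m ℝ) := Matrix.linftyOpNormedRing
  let _ : NormedAlgebra ℝ (Matrix m m ℝ) := Matrix.linftyOpNormedAlgebra
  let L : Matrix m m ℝ →ₗ[ℝ] (m → ℝ) := (Matrix.mulVecBilin ℝ ℝ).flip u
  have h := (LinearMap.toContinuousLinearMap L).hasFDerivAt.comp_hasDerivAt t
    (hasDerivAt_exp_smul_const' A t)
  exact h

lemma matrix_exp_smul_one (a : ℝ) :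
    NormedSpace.exp (a • (1 : Matrix m m ℝ)) = Real.exp a • 1 := by
  rw [← Matrix.diagonal_one, ← Matrix.diagonal_smul, Matrix.exp_diagonal, ← Matrix.diagonal_smul]
  congr 1
  funext i
  rw [Pi.coe_exp]
  simp [Real.exp_eq_exp_ℝ]

lemma matrix_exp_smul_one_sub (a : ℝ) (A : Matrix m m ℝ) :
    NormedSpace.exp (a • (1 - A)) = Real.exp a • NormedSpace.exp (-a • A) := by
  have h : a • (1 - A) = a • (1 : Matrix m m ℝ) + -a • A := by
    rw [smul_sub, neg_smul, sub_eq_add_neg]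
  rw [h, Matrix.exp_add_of_commute, matrix_exp_smul_one, smul_mul_assoc, one_mul]
  exact ((Commute.one_left A).smul_left a).smul_right (-a)

lemma matrix_exp_half_smul_mul_self (a : ℝ) (A : Matrix m m ℝ) :
    NormedSpace.exp ((a / 2) • A) * NormedSpace.exp ((a / 2) • A) = NormedSpace.exp (a • A) := by
  rw [← Matrix.exp_add_of_commute _ _ (Commute.refl _), ← add_smul, add_halves]

end MatrixExponential

variable {N : ℕ}

lemma interactionMatrix_isSymm (x : Fin N → ℝ) : (interactionMatrix x).IsSymm := by
  refine Matrix.IsSymm.ext fun i j => ?_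
  simp only [interactionMatrix, Matrix.of_apply]
  by_cases h : i = j
  · subst h; rfl
  · rw [if_neg h, if_neg (Ne.symm h), ← neg_sub (x i) (x j), neg_sq]

/-- Strict diagonal dominance: the rows of `A` sum to `0` and its off-diagonal entries are
nonnegative, so each diagonal entry of `1 - A` exceeds the sum of the other absolute values by `1`.
-/
lemma isUnit_one_sub_interactionMatrix (x : Fin N → ℝ) : IsUnit (1 - interactionMatrix x) := by
  rw [Matrix.isUnit_iff_isUnit_det, isUnit_iff_ne_zero]
  refine det_ne_zero_of_sum_row_lt_diag fun i => ?_
  have h1 : ∑ j ∈ Finset.univ.erase i, ‖(1 - interactionMatrix x) i j‖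
      = ∑ j ∈ Finset.univ.erase i, 1 / (x i - x j) ^ 2 := by
    refine Finset.sum_congr rfl fun j hj => ?_
    have hij : i ≠ j := (Finset.ne_of_mem_erase hj).symm
    rw [Matrix.sub_apply, Matrix.one_apply_ne hij, interactionMatrix, Matrix.of_apply, if_neg hij,
      zero_sub, norm_neg, Real.norm_of_nonneg (by positivity)]
  have h2 : (1 - interactionMatrix x) i i = 1 + ∑ j ∈ Finset.univ.erase i, 1 / (x i - x j) ^ 2 := by
    rw [Matrix.sub_apply, Matrix.one_apply_eq, interactionMatrix, Matrix.of_apply, if_pos rfl,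
      sub_neg_eq_add]
  have h3 : 0 ≤ ∑ j ∈ Finset.univ.erase i, 1 / (x i - x j) ^ 2 :=
    Finset.sum_nonneg fun j _ => by positivity
  rw [h1, h2, Real.norm_of_nonneg (by positivity)]
  linarith

variable {lam c t s : ℝ}

/-- The logarithm of the quotient of the growth function at two times. -/
noncomputable def logGrowth (lam c t s : ℝ) : ℝ := Real.log (growth lam c s / growth lam c t)

lemma logGrowth_self (hc : 0 < c) (ht : 0 ≤ t) : logGrowth lam c t t = 0 := by
  rw [logGrowth, div_self (growth_pos lam hc ht).ne', Real.log_one]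

lemma exp_logGrowth (hc : 0 < c) (ht : 0 ≤ t) (hs : 0 ≤ s) :
    Real.exp (logGrowth lam c t s) = growth lam c s / growth lam c t :=
  Real.exp_log (div_pos (growth_pos lam hc hs) (growth_pos lam hc ht))

/-- Up to the factor 2, `logGrowth` is the clock in which the coefficient `r⁻² A` becomes constant.
-/
lemma hasDerivAt_logGrowth (hlam : lam ≠ 0) (hc : 0 < c) (ht : 0 ≤ t) (hs : 0 ≤ s) :
    HasDerivAt (logGrowth lam c t) (2 / radius lam c s ^ 2) s := by
  have hgt := growth_pos lam hc ht
  have hgs := growth_pos lam hc hs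
  have h := ((hasDerivAt_growth hlam c s).div_const (growth lam c t)).log (div_pos hgs hgt).ne'
  refine h.congr_deriv ?_
  have h3 : Real.exp (-2 * lam * s) * Real.exp (2 * lam * s) = 1 := by
    rw [← Real.exp_add]; simp
  rw [radius_sq lam hc hs]
  rw [show -2 * lam * s = -(2 * lam * s) by ring] at h3 ⊢
  field_simp
  linear_combination h3

/-- The solution of the adjoint equation `f' = -(r⁻² A - lam) f` with terminal value `u`. -/
noncomputable def adjointFlow (A : Matrix (Fin N) (Fin N) ℝ) (lam c t : ℝ) (u : Fin N → ℝ) (s : ℝ) :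
    Fin N → ℝ :=
  Real.exp (-lam * (t - s)) • (NormedSpace.exp ((-logGrowth lam c t s / 2) • A)).mulVec u

variable (A : Matrix (Fin N) (Fin N) ℝ) (u : Fin N → ℝ)

lemma adjointFlow_self (hc : 0 < c) (ht : 0 ≤ t) : adjointFlow A lam c t u t = u := by
  simp [adjointFlow, logGrowth_self hc ht]

lemma hasDerivAt_adjointFlow (hlam : lam ≠ 0) (hc : 0 < c) (ht : 0 ≤ t) (hs : 0 ≤ s) :
    HasDerivAt (adjointFlow A lam c t u)
      (-((radius lam c s ^ 2)⁻¹ • A - lam • 1).mulVec (adjointFlow A lam c t u s)) s := by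
  have h1 : HasDerivAt (fun s : ℝ => Real.exp (-lam * (t - s)))
      (Real.exp (-lam * (t - s)) * lam) s := by
    simpa using (((hasDerivAt_id s).const_sub t).const_mul (-lam)).exp
  have h2 := ((hasDerivAt_logGrowth hlam hc ht hs).neg.div_const 2)
  have h3 := (hasDerivAt_matrix_exp_smul_mulVec A u (-logGrowth lam c t s / 2)).scomp s h2
  refine (h1.smul h3).congr_deriv ?_
  have hr := (radius_pos lam hc hs).ne'
  rw [adjointFlow, Matrix.sub_mulVec, Matrix.smul_mulVec, Matrix.smul_mulVec, Matrix.one_mulVec,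
    Matrix.mulVec_smul, ← Matrix.mulVec_mulVec]
  ext i
  simp only [Function.comp_apply, Pi.add_apply, Pi.smul_apply, Pi.neg_apply, Pi.sub_apply,
    smul_eq_mul]
  field_simp
  ring

variable {A}

lemma adjointFlow_dotProduct_self (hA : A.IsSymm) :
    adjointFlow A lam c t u s ⬝ᵥ adjointFlow A lam c t u s
      = Real.exp (-2 * lam * (t - s))
        * (u ⬝ᵥ (NormedSpace.exp (-logGrowth lam c t s • A)).mulVec u) := by
  have hF : (NormedSpace.exp ((-logGrowth lam c t s / 2) • A)).IsSymm :=
    (hA.smul _).exp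
  rw [adjointFlow, smul_dotProduct, dotProduct_smul, smul_smul, ← Real.exp_add, smul_eq_mul,
    Matrix.dotProduct_mulVec, ← Matrix.mulVec_transpose, hF.eq, Matrix.mulVec_mulVec,
    matrix_exp_half_smul_mul_self, dotProduct_comm]
  ring_nf

/-- The covariance matrix of the solutions of the linear equation at time `t`. -/
noncomputable def limitCov (A : Matrix (Fin N) (Fin N) ℝ) (lam c t : ℝ) :
    Matrix (Fin N) (Fin N) ℝ :=
  ((1 + Real.exp (-2 * lam * t) * (lam * c ^ 2 - 1)) / (2 * lam)) •
    ((1 - A)⁻¹ * (1 - NormedSpace.exp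
      (Real.log (lam * c ^ 2 / (Real.exp (2 * lam * t) - 1 + lam * c ^ 2)) • (1 - A))))

/-- In terms of `growth` the factors `lam` cancel, and the logarithm in the covariance formula is
the clock at time `0`. -/
lemma limitCov_eq (hlam : lam ≠ 0) (hc : 0 < c) (ht : 0 ≤ t) :
    limitCov A lam c t = (radius lam c t ^ 2 / 2) •
      ((1 - A)⁻¹ * (1 - NormedSpace.exp (logGrowth lam c t 0 • (1 - A)))) := by
  have h3 : Real.exp (-2 * lam * t) * Real.exp (2 * lam * t) = 1 := by
    rw [← Real.exp_add]; simp
  have h4 : (1 + Real.exp (-2 * lam * t) * (lam * c ^ 2 - 1)) / (2 * lam)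
      = radius lam c t ^ 2 / 2 := by
    rw [radius_sq lam hc ht, growth]
    rw [show -2 * lam * t = -(2 * lam * t) by ring] at h3 ⊢
    field_simp
    linear_combination -h3
  have h5 : lam * c ^ 2 / (Real.exp (2 * lam * t) - 1 + lam * c ^ 2)
      = growth lam c 0 / growth lam c t := by
    have hg := (growth_pos lam hc ht).ne'
    have h6 : Real.exp (2 * lam * t) - 1 + lam * c ^ 2 = lam * growth lam c t := by
      rw [growth]; field_simp; ring
    have h7 : growth lam c 0 = c ^ 2 := by simp [growth]
    rw [h6, h7]
    exact mul_div_mul_left _ _ hlam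
  rw [limitCov, h4, h5, logGrowth]

lemma limitCov_isSymm (hA : A.IsSymm) (hu : IsUnit (1 - A)) : (limitCov A lam c t).IsSymm := by
  rw [limitCov]
  refine Matrix.IsSymm.smul ?_ _
  have h1 : (1 - A).IsSymm := Matrix.isSymm_one.sub hA
  generalize Real.log (lam * c ^ 2 / (Real.exp (2 * lam * t) - 1 + lam * c ^ 2)) = a
  have h2 : (NormedSpace.exp (a • (1 - A))).IsSymm := (h1.smul a).exp
  rw [Matrix.IsSymm, Matrix.transpose_mul, Matrix.transpose_nonsing_inv, h1.eq,
    (Matrix.isSymm_one.sub h2).eq]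
  have hcomm : Commute (1 - A) (NormedSpace.exp (a • (1 - A))) := by
    let _ : NormedRing (Matrix (Fin N) (Fin N) ℝ) := Matrix.linftyOpNormedRing
    let _ : NormedAlgebra ℝ (Matrix (Fin N) (Fin N) ℝ) := Matrix.linftyOpNormedAlgebra
    exact ((Commute.refl (1 - A)).smul_right a).exp_right
  obtain ⟨U, hU⟩ := hu
  rw [← hU] at hcomm ⊢
  rw [← Matrix.coe_units_inv]
  exact (((Commute.one_left _).sub_left hcomm.symm).units_inv_right).eq

lemma integral_adjointFlow_dotProduct_self (hA : A.IsSymm) (hu : IsUnit (1 - A)) (hlam : lam ≠ 0)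
    (hc : 0 < c) (ht : 0 ≤ t) :
    ∫ s in (0 : ℝ)..t, adjointFlow A lam c t u s ⬝ᵥ adjointFlow A lam c t u s
      = u ⬝ᵥ (limitCov A lam c t).mulVec u := by
  have hinv : (1 - A)⁻¹ * (1 - A) = 1 :=
    Matrix.nonsing_inv_mul _ ((Matrix.isUnit_iff_isUnit_det _).1 hu)
  -- Antiderivative: with `L = logGrowth lam c t s`, one has `exp (L (1 - A)) = exp L • exp (-L A)`
  -- and `exp L = growth s / growth t`. Multiplied by `L' = 2 / r(s)²` and `r(t)² / 2`, the scalar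
  -- factor is `exp (-2 lam (t - s))`, as in the integrand.
  set h : ℝ → ℝ := fun s => radius lam c t ^ 2 / 2 * (u ⬝ᵥ (1 - A)⁻¹.mulVec
    ((NormedSpace.exp (logGrowth lam c t s • (1 - A))).mulVec u)) with hh
  have hderiv : ∀ s, 0 ≤ s → HasDerivAt h
      (adjointFlow A lam c t u s ⬝ᵥ adjointFlow A lam c t u s) s := by
    intro s hs
    have h1 := (hasDerivAt_matrix_exp_smul_mulVec (1 - A) u (logGrowth lam c t s)).scomp s
      (hasDerivAt_logGrowth hlam hc ht hs)
    have h2 : ∀ v : ℝ → Fin N → ℝ, ∀ v', HasDerivAt v v' s →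
        HasDerivAt (fun s => u ⬝ᵥ (1 - A)⁻¹.mulVec (v s)) (u ⬝ᵥ (1 - A)⁻¹.mulVec v') s := by
      intro v v' hv
      simp only [Matrix.mulVec, dotProduct]
      exact HasDerivAt.fun_sum fun i _ => (HasDerivAt.fun_sum fun j _ =>
        (hasDerivAt_pi.1 hv j).const_mul _).const_mul _
    refine ((h2 _ _ h1).const_mul (radius lam c t ^ 2 / 2)).congr_deriv ?_
    have hgt := (growth_pos lam hc ht).ne'
    have hgs := (growth_pos lam hc hs).ne'
    rw [adjointFlow_dotProduct_self u hA, Matrix.mulVec_smul, Matrix.mulVec_mulVec, ← mul_assoc,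
      hinv, one_mul, matrix_exp_smul_one_sub, Matrix.smul_mulVec, dotProduct_smul,
      dotProduct_smul, exp_logGrowth hc ht hs, radius_sq lam hc ht, radius_sq lam hc hs,
      smul_eq_mul, smul_eq_mul]
    have he : Real.exp (-2 * lam * (t - s)) * Real.exp (-2 * lam * s)
        = Real.exp (-2 * lam * t) := by
      rw [← Real.exp_add]; ring_nf
    have hes := (Real.exp_pos (-2 * lam * s)).ne'
    rw [← he]
    field_simp
  have hder : ∀ s ∈ Set.uIcc 0 t, HasDerivAt h
      (adjointFlow A lam c t u s ⬝ᵥ adjointFlow A lam c t u s) s :=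
    fun s hs => hderiv s (Icc_zero_subset_Ici ht hs)
  have hcont : ContinuousOn (fun s => adjointFlow A lam c t u s ⬝ᵥ adjointFlow A lam c t u s)
      (Set.uIcc 0 t) := by
    have : ContinuousOn (adjointFlow A lam c t u) (Set.uIcc 0 t) := fun s hs =>
      (hasDerivAt_adjointFlow A u hlam hc ht
        (Icc_zero_subset_Ici ht hs)).continuousAt.continuousWithinAt
    simp only [dotProduct]
    exact continuousOn_finsetSum _ fun i _ =>
      ((continuous_apply i).comp_continuousOn this).mul
        ((continuous_apply i).comp_continuousOn this)
  rw [intervalIntegral.integral_eq_sub_of_hasDerivAt hder hcont.intervalIntegrable,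
    limitCov_eq hlam hc ht, hh]
  simp only [logGrowth_self hc ht, zero_smul, NormedSpace.exp_zero, Matrix.one_mulVec,
    Matrix.smul_mulVec, dotProduct_smul, smul_eq_mul, mul_sub, mul_one, Matrix.sub_mulVec,
    dotProduct_sub, Matrix.mulVec_mulVec]

end BesselOU

/-! ### Riemann sums and the Gaussian law of Wiener integrals -/

namespace BesselOU

section RiemannSums

/-- The `k`-th point of the partition of `[0, t]` into `n + 1` intervals of equal length. -/
noncomputable def mesh (t : ℝ) (n k : ℕ) : ℝ := t / (n + 1) * k

variable {t : ℝ} {n k : ℕ}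

lemma mesh_zero (t : ℝ) (n : ℕ) : mesh t n 0 = 0 := by simp [mesh]

lemma mesh_last (t : ℝ) (n : ℕ) : mesh t n (n + 1) = t := by
  rw [mesh]
  push_cast
  field_simp

lemma mesh_succ (t : ℝ) (n k : ℕ) : mesh t n (k + 1) = mesh t n k + t / (n + 1) := by
  simp only [mesh]
  push_cast
  ring

lemma mesh_mono (ht : 0 ≤ t) (n : ℕ) : Monotone (mesh t n) :=
  monotone_nat_of_le_succ fun k => by
    rw [mesh_succ]
    exact le_add_of_nonneg_right (by positivity)

lemma mesh_nonneg (ht : 0 ≤ t) (n k : ℕ) : 0 ≤ mesh t n k := by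
  unfold mesh; positivity

lemma sum_integral_mesh {f : ℝ → ℝ} (hf : Continuous f) (t : ℝ) (n : ℕ) :
    ∑ k ∈ Finset.range (n + 1), ∫ s in mesh t n k..mesh t n (k + 1), f s
      = ∫ s in (0 : ℝ)..t, f s := by
  rw [intervalIntegral.sum_integral_adjacent_intervals fun k _ => hf.intervalIntegrable _ _,
    mesh_zero, mesh_last]

/-- Uniform continuity of `h` on `[0, t]`. The tags are free because the variance sums use left
endpoints and summation by parts produces right ones. -/
lemma tendsto_sum_mul_integral_mesh {h g : ℝ → ℝ} (hh : Continuous h) (hg : Continuous g)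
    (ht : 0 ≤ t) {θ : ℕ → ℕ → ℝ} (hθ : ∀ n k, θ n k ∈ Set.Icc (mesh t n k) (mesh t n (k + 1))) :
    Tendsto (fun n => ∑ k ∈ Finset.range (n + 1),
      h (θ n k) * ∫ s in mesh t n k..mesh t n (k + 1), g s) atTop
      (nhds (∫ s in (0 : ℝ)..t, h s * g s)) := by
  rw [Metric.tendsto_nhds]
  intro ε hε
  have hI : 0 ≤ ∫ s in (0 : ℝ)..t, |g s| :=
    intervalIntegral.integral_nonneg ht fun s _ => abs_nonneg _
  set η := ε / ((∫ s in (0 : ℝ)..t, |g s|) + 1) with hη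
  have hη0 : 0 < η := by positivity
  obtain ⟨δ, hδ, hδh⟩ := Metric.uniformContinuousOn_iff.1
    ((isCompact_Icc (a := (0 : ℝ)) (b := t)).uniformContinuousOn_of_continuous hh.continuousOn)
    η hη0
  have hstep : Tendsto (fun n : ℕ => t / ((n : ℝ) + 1)) atTop (nhds 0) :=
    tendsto_const_nhds.div_atTop (tendsto_natCast_atTop_atTop.atTop_add tendsto_const_nhds)
  filter_upwards [hstep.eventually_lt_const hδ] with n hn
  have hdiff : ∑ k ∈ Finset.range (n + 1), h (θ n k) * (∫ s in mesh t n k..mesh t n (k + 1), g s)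
      - ∫ s in (0 : ℝ)..t, h s * g s
      = ∑ k ∈ Finset.range (n + 1),
        ∫ s in mesh t n k..mesh t n (k + 1), (h (θ n k) - h s) * g s := by
    have hhg : Continuous fun s => h s * g s := hh.mul hg
    rw [← sum_integral_mesh hhg t n, ← Finset.sum_sub_distrib]
    refine Finset.sum_congr rfl fun k _ => ?_
    rw [← intervalIntegral.integral_const_mul, ← intervalIntegral.integral_sub
      ((hg.const_mul _).intervalIntegrable _ _) (hhg.intervalIntegrable _ _)]
    simp only [sub_mul]
  have hle : ∀ k ∈ Finset.range (n + 1),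
      |∫ s in mesh t n k..mesh t n (k + 1), (h (θ n k) - h s) * g s|
        ≤ ∫ s in mesh t n k..mesh t n (k + 1), η * |g s| := by
    intro k hk
    rw [← Real.norm_eq_abs]
    refine intervalIntegral.norm_integral_le_of_norm_le (mesh_mono ht n (Nat.le_add_right k 1))
      (Eventually.of_forall fun s hs => ?_) ((hg.abs.const_mul η).intervalIntegrable _ _)
    rw [Real.norm_eq_abs, abs_mul]
    have hk1 : mesh t n (k + 1) ≤ t := by
      exact (mesh_mono ht n (Finset.mem_range.1 hk)).trans_eq (mesh_last t n)
    have h0 := mesh_nonneg ht n k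
    have hθk := hθ n k
    have hsucc := mesh_succ t n k
    gcongr
    refine (hδh _ ⟨h0.trans hθk.1, hθk.2.trans hk1⟩ s ⟨h0.trans hs.1.le, hs.2.trans hk1⟩ ?_).le
    rw [Real.dist_eq, abs_lt]
    constructor <;> linarith [hθk.1, hθk.2, hs.1, hs.2]
  rw [Real.dist_eq, hdiff]
  calc _ ≤ ∑ k ∈ Finset.range (n + 1), ∫ s in mesh t n k..mesh t n (k + 1), η * |g s| :=
        (Finset.abs_sum_le_sum_abs _ _).trans (Finset.sum_le_sum hle)
    _ = η * ∫ s in (0 : ℝ)..t, |g s| := by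
        rw [sum_integral_mesh (hg.abs.const_mul η), intervalIntegral.integral_const_mul]
    _ < η * ((∫ s in (0 : ℝ)..t, |g s|) + 1) := by gcongr; linarith
    _ = ε := by rw [hη]; field_simp

lemma tendsto_sum_mul_mesh {h : ℝ → ℝ} (hh : Continuous h) (ht : 0 ≤ t) :
    Tendsto (fun n => ∑ k ∈ Finset.range (n + 1),
      h (mesh t n k) * (mesh t n (k + 1) - mesh t n k)) atTop
      (nhds (∫ s in (0 : ℝ)..t, h s)) := by
  have := tendsto_sum_mul_integral_mesh (t := t) hh continuous_const (g := fun _ => 1) ht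
    (θ := fun n k => mesh t n k) fun n k => ⟨le_rfl, mesh_mono ht n k.le_succ⟩
  simpa using this

/-- Integration by parts for the integral of a smooth function along a continuous path. -/
lemma tendsto_sum_mul_increment {f f' b : ℝ → ℝ} (hf : ∀ s, HasDerivAt f (f' s) s)
    (hf' : Continuous f') (hb : Continuous b) (hb0 : b 0 = 0) (ht : 0 ≤ t) :
    Tendsto (fun n => ∑ k ∈ Finset.range (n + 1),
      f (mesh t n k) * (b (mesh t n (k + 1)) - b (mesh t n k))) atTop
      (nhds (f t * b t - ∫ s in (0 : ℝ)..t, b s * f' s)) := by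
  have h1 := tendsto_sum_mul_integral_mesh (t := t) hb hf' ht
    (θ := fun n k => mesh t n (k + 1)) fun n k => ⟨mesh_mono ht n k.le_succ, le_rfl⟩
  refine (h1.const_sub (f t * b t)).congr fun n => ?_
  have h2 : ∀ k, ∫ s in mesh t n k..mesh t n (k + 1), f' s
      = f (mesh t n (k + 1)) - f (mesh t n k) := fun k =>
    intervalIntegral.integral_eq_sub_of_hasDerivAt (fun s _ => hf s) (hf'.intervalIntegrable _ _)
  -- Summation by parts: the telescoping sum of `f * b`, less the increments of `f` against `b` at
  -- right endpoints.
  have h3 := Finset.sum_range_sub (fun k => f (mesh t n k) * b (mesh t n k)) (n + 1)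
  rw [mesh_last, mesh_zero, hb0, mul_zero, sub_zero] at h3
  rw [← h3, ← Finset.sum_sub_distrib]
  refine Finset.sum_congr rfl fun k _ => ?_
  rw [h2]
  ring

end RiemannSums

section Gaussian

variable {Ω : Type*} [MeasurableSpace Ω] {P : Measure Ω}

lemma hasLaw_gaussianReal_sum {ι : Type*} {S : Finset ι} {X : ι → Ω → ℝ} {v : ι → ℝ≥0}
    (h : ∀ i ∈ S, HasLaw (X i) (gaussianReal 0 (v i)) P) (hi : iIndepFun X P) :
    HasLaw (fun ω => ∑ i ∈ S, X i ω) (gaussianReal 0 (∑ i ∈ S, v i)) P := by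
  have hm : ∀ i ∈ S, AEMeasurable (X i) P := fun i hi => (h i hi).aemeasurable
  have hsum : AEMeasurable (fun ω => ∑ i ∈ S, X i ω) P := Finset.aemeasurable_fun_sum S hm
  have := hi.isProbabilityMeasure
  have := Measure.isProbabilityMeasure_map hsum
  refine ⟨hsum, Measure.ext_of_charFun ?_⟩
  rw [(hi.restrict S).charFun_map_fun_finsetSum_eq_prod hm]
  funext ξ
  rw [Finset.prod_apply, Finset.prod_congr rfl fun i hi => by
    rw [(h i hi).map_eq, charFun_gaussianReal], ← Complex.exp_sum, charFun_gaussianReal]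
  simp [Finset.sum_div, Finset.sum_mul]

/-- Characteristic functions converge by dominated convergence, and those of the Gaussians converge
with the variances. -/
lemma hasLaw_gaussianReal_of_tendsto [IsProbabilityMeasure P] {X : ℕ → Ω → ℝ} {Z : Ω → ℝ}
    {v : ℕ → ℝ≥0} {w : ℝ≥0} (hX : ∀ n, HasLaw (X n) (gaussianReal 0 (v n)) P)
    (hv : Tendsto v atTop (nhds w)) (hXZ : ∀ᵐ ω ∂P, Tendsto (fun n => X n ω) atTop (nhds (Z ω))) :
    HasLaw Z (gaussianReal 0 w) P := by
  have hZ : AEMeasurable Z P :=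
    aemeasurable_of_tendsto_metrizable_ae atTop (fun n => (hX n).aemeasurable) hXZ
  refine ⟨hZ, ?_⟩
  have := Measure.isProbabilityMeasure_map hZ
  refine Measure.ext_of_charFun ?_
  funext ξ
  have hchar : ∀ Y : Ω → ℝ, AEMeasurable Y P →
      charFun (P.map Y) ξ = ∫ ω, Complex.exp (ξ * Y ω * Complex.I) ∂P := by
    intro Y hY
    rw [charFun_apply_real, integral_map hY (by fun_prop)]
  have h1 : Tendsto (fun n => charFun (P.map (X n)) ξ) atTop (nhds (charFun (P.map Z) ξ)) := by
    rw [hchar Z hZ]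
    simp_rw [fun n => hchar (X n) (hX n).aemeasurable]
    refine tendsto_integral_of_dominated_convergence (fun _ => 1) (fun n => ?_)
      (integrable_const _) (fun n => ?_) ?_
    · have := (hX n).aemeasurable
      exact AEMeasurable.aestronglyMeasurable (by fun_prop)
    · refine Eventually.of_forall fun ω => ?_
      rw [← Complex.ofReal_mul, Complex.norm_exp_ofReal_mul_I]
    · filter_upwards [hXZ] with ω hω
      have : Continuous fun x : ℝ => Complex.exp (ξ * x * Complex.I) := by fun_prop
      exact (this.tendsto _).comp hω
  have h2 : Tendsto (fun n => charFun (P.map (X n)) ξ) atTop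
      (nhds (charFun (gaussianReal 0 w) ξ)) := by
    simp_rw [fun n => (hX n).map_eq, charFun_gaussianReal]
    have hv' : Tendsto (fun n => ((v n : ℝ) : ℂ)) atTop (nhds ((w : ℝ) : ℂ)) :=
      (Complex.continuous_ofReal.tendsto _).comp ((NNReal.continuous_coe.tendsto _).comp hv)
    exact (Complex.continuous_exp.tendsto _).comp
      (tendsto_const_nhds.sub ((hv'.mul_const _).div_const _))
  exact tendsto_nhds_unique h1 h2


variable {N : ℕ}

/-- The Wiener integral of a smooth deterministic function, written by integration by parts, is a
centered Gaussian variable, with variance given by the Itô isometry. -/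
theorem IsBrownian.hasLaw_integral {B : ℝ≥0 → Ω → Fin N → ℝ} (hB : IsBrownian B P)
    {f f' : ℝ → Fin N → ℝ} (hf : ∀ s, HasDerivAt f (f' s) s) (hf' : Continuous f')
    {t : ℝ} (ht : 0 ≤ t) :
    HasLaw (fun ω => ∑ i, (f t i * B t.toNNReal ω i
        - ∫ s in (0 : ℝ)..t, B s.toNNReal ω i * f' s i))
      (gaussianReal 0 (∫ s in (0 : ℝ)..t, f s ⬝ᵥ f s).toNNReal) P := by
  have := hB.indep.isProbabilityMeasure
  have hfc : Continuous f := continuous_iff_continuousAt.2 fun s => (hf s).continuousAt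
  -- The variances of the Riemann sums, coordinate by coordinate; by `hvcoe` their total is a
  -- Riemann sum of `∫ f ⬝ᵥ f`.
  set v : ℕ → Fin N → ℝ≥0 := fun n i => ∑ k ∈ Finset.range (n + 1),
    .mk (f (mesh t n k) i ^ 2) (sq_nonneg _) * nndist ((mesh t n (k + 1)).toNNReal : ℝ)
      ((mesh t n k).toNNReal : ℝ) with hv
  have hvcoe : ∀ n, ((∑ i, v n i : ℝ≥0) : ℝ) = ∑ k ∈ Finset.range (n + 1),
      (f (mesh t n k) ⬝ᵥ f (mesh t n k)) * (mesh t n (k + 1) - mesh t n k) := by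
    intro n
    simp only [dotProduct, Finset.sum_mul]
    rw [Finset.sum_comm]
    simp only [NNReal.coe_sum]
    refine Finset.sum_congr rfl fun k _ => Finset.sum_congr rfl fun i _ => ?_
    rw [NNReal.coe_mul, coe_nndist, Real.coe_toNNReal _ (mesh_nonneg ht _ _),
      Real.coe_toNNReal _ (mesh_nonneg ht _ _), Real.dist_eq,
      abs_of_nonneg (sub_nonneg.2 (mesh_mono ht n (Nat.le_add_right k 1)))]
    simp [sq]
  refine hasLaw_gaussianReal_of_tendsto
    (X := fun n ω => ∑ i, ∑ k ∈ Finset.range (n + 1), f (mesh t n k) i *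
      (B (mesh t n (k + 1)).toNNReal ω i - B (mesh t n k).toNNReal ω i))
    (v := fun n => ∑ i, v n i) (fun n => ?_) ?_ ?_
  · refine hasLaw_gaussianReal_sum (fun i _ => ?_) ?_
    · refine hasLaw_gaussianReal_sum (fun k _ => ?_) ?_
      · have h := gaussianReal_const_mul ((hB.coord i).hasLaw_sub (mesh t n (k + 1)).toNNReal
          (mesh t n k).toNNReal) (f (mesh t n k) i)
        rw [mul_zero] at h
        exact h
      · have h := (hB.coord i).hasIndepIncrements.nat
          (t := fun k => (mesh t n k).toNNReal)
          (fun j k hjk => Real.toNNReal_le_toNNReal (mesh_mono ht n hjk))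
        exact h.comp (fun k x => f (mesh t n k) i * x) fun k => by fun_prop
    · exact hB.indep.comp (fun i (p : ℝ≥0 → ℝ) => ∑ k ∈ Finset.range (n + 1), f (mesh t n k) i *
        (p (mesh t n (k + 1)).toNNReal - p (mesh t n k).toNNReal)) fun i => by fun_prop
  · have h := tendsto_sum_mul_mesh (h := fun s => f s ⬝ᵥ f s)
      (by simp only [dotProduct]; fun_prop) ht
    have h' := (continuous_real_toNNReal.tendsto _).comp h
    refine h'.congr fun n => ?_
    rw [Function.comp_apply, ← hvcoe, Real.toNNReal_coe]
  · have h0 : ∀ᵐ ω ∂P, ∀ i, B 0 ω i = 0 := ae_all_iff.2 fun i => (hB.coord i).eval_zero_ae_eq_zero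
    have hc : ∀ᵐ ω ∂P, ∀ i, Continuous fun t => B t ω i := ae_all_iff.2 fun i => (hB.coord i).cont
    filter_upwards [h0, hc] with ω h0 hc
    refine tendsto_finsetSum _ fun i _ => ?_
    have hb := hc i
    exact tendsto_sum_mul_increment (f := fun s => f s i) (f' := fun s => f' s i)
      (b := fun s => B s.toNNReal ω i) (fun s => hasDerivAt_pi.1 (hf s) i) (by fun_prop)
      (hb.comp continuous_real_toNNReal) (by simpa using h0 i) ht

end Gaussian

end BesselOU

/-! ### Variation of constants and the covariance matrix -/

namespace BesselOU

variable {N : ℕ} {z : Fin N → ℝ} {lam c : ℝ}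

lemma dotProduct_mulVec_comm {M : Matrix (Fin N) (Fin N) ℝ} (hM : M.IsSymm) (x y : Fin N → ℝ) :
    M.mulVec x ⬝ᵥ y = x ⬝ᵥ M.mulVec y := by
  rw [Matrix.dotProduct_mulVec, ← Matrix.mulVec_transpose, hM.eq]

/-- Positivity of `radius` is known only for nonnegative times. Freezing it at `max s 0` gives a
drift continuous on the whole line, so that primitives have two-sided derivatives at `0` too. -/
lemma continuous_linearDrift_max (A : Matrix (Fin N) (Fin N) ℝ) (hc : 0 < c) {g : ℝ → Fin N → ℝ}
    (hg : Continuous g) :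
    Continuous fun s => ((radius lam c (max s 0) ^ 2)⁻¹ • A - lam • 1).mulVec (g s) := by
  have h1 : Continuous fun s : ℝ => (radius lam c (max s 0) ^ 2)⁻¹ := by
    have h2 : Continuous fun s : ℝ => radius lam c (max s 0) ^ 2 := by fun_prop
    exact h2.inv₀ fun s => (pow_pos (radius_pos lam hc (le_max_right s 0)) 2).ne'
  simp only [Matrix.sub_mulVec, Matrix.smul_mulVec, Matrix.one_mulVec]
  have h3 : Continuous fun s => A.mulVec (g s) := Continuous.matrix_mulVec continuous_const hg
  fun_prop

/-- The adjoint flow agrees on `[0, ∞)` with a continuously differentiable function on the line. -/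
lemma exists_adjointFlow_extension (A : Matrix (Fin N) (Fin N) ℝ) (u : Fin N → ℝ) (hlam : lam ≠ 0)
    (hc : 0 < c) {t : ℝ} (ht : 0 ≤ t) :
    ∃ f f' : ℝ → Fin N → ℝ, (∀ s, HasDerivAt f (f' s) s) ∧ Continuous f' ∧
      ∀ s, 0 ≤ s → f s = adjointFlow A lam c t u s ∧
        f' s = -((radius lam c s ^ 2)⁻¹ • A - lam • 1).mulVec (f s) := by
  set f' : ℝ → Fin N → ℝ := fun s => -((radius lam c (max s 0) ^ 2)⁻¹ • A - lam • 1).mulVec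
    (adjointFlow A lam c t u (max s 0)) with hf'
  have hcont : Continuous f' := by
    have h1 : Continuous fun s : ℝ => adjointFlow A lam c t u (max s 0) := by
      refine continuous_iff_continuousAt.2 fun s => ?_
      exact ContinuousAt.comp (f := fun s : ℝ => max s 0)
        (hasDerivAt_adjointFlow A u hlam hc ht (le_max_right s 0)).continuousAt (by fun_prop)
    exact (continuous_linearDrift_max A hc h1).neg
  refine ⟨fun s => adjointFlow A lam c t u 0 + ∫ r in (0 : ℝ)..s, f' r, f',
    fun s => (hcont.integral_hasStrictDerivAt 0 s).hasDerivAt.const_add _, hcont, fun s hs => ?_⟩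
  have h2 : adjointFlow A lam c t u 0 + ∫ r in (0 : ℝ)..s, f' r = adjointFlow A lam c t u s := by
    rw [intervalIntegral.integral_eq_sub_of_hasDerivAt (f := adjointFlow A lam c t u)
      (fun r hr => ?_) (hcont.intervalIntegrable _ _), add_sub_cancel]
    have hr0 : 0 ≤ r := Icc_zero_subset_Ici hs hr
    have h3 := hasDerivAt_adjointFlow A u hlam hc ht hr0
    simpa only [hf', max_eq_left hr0] using h3
  refine ⟨h2, ?_⟩
  change f' s = -((radius lam c s ^ 2)⁻¹ • A - lam • 1).mulVec
    (adjointFlow A lam c t u 0 + ∫ r in (0 : ℝ)..s, f' r)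
  rw [h2]
  simp only [hf', max_eq_left hs]

/-- Variation of constants for the linear equation, along a path. -/
lemma dotProduct_fluctuation_eq (hz : IsHermiteZeros z) (hlam : lam ≠ 0) (hc : 0 < c)
    {b w : ℝ≥0 → Fin N → ℝ} {w₀ : Fin N → ℝ} (hb : Continuous b) (hw : Continuous w)
    (hweq : ∀ (t : ℝ≥0) i, w t i = w₀ i + b t i
      + ∫ s in (0 : ℝ)..t, (driftMatrix lam (c • z) s).mulVec (w s.toNNReal) i)
    {f f' : ℝ → Fin N → ℝ} (hf : ∀ s, HasDerivAt f (f' s) s) (hf' : Continuous f')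
    (hff' : ∀ s, 0 ≤ s →
      f' s = -((radius lam c s ^ 2)⁻¹ • interactionMatrix z - lam • 1).mulVec (f s)) (t : ℝ≥0) :
    f t ⬝ᵥ w t = f 0 ⬝ᵥ w₀
      + ∑ i, (f t i * b t i - ∫ s in (0 : ℝ)..t, b s.toNNReal i * f' s i) := by
  set M : ℝ → Matrix (Fin N) (Fin N) ℝ :=
    fun s => (radius lam c s ^ 2)⁻¹ • interactionMatrix z - lam • 1 with hM
  have hMsymm : ∀ s, (M s).IsSymm := fun s =>
    ((interactionMatrix_isSymm z).smul _).sub (Matrix.isSymm_one.smul _)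
  have hg : Continuous fun s => (M (max s 0)).mulVec (w s.toNNReal) :=
    continuous_linearDrift_max _ hc (by fun_prop)
  have hgi : ∀ i, Continuous fun s => (M (max s 0)).mulVec (w s.toNNReal) i := fun i =>
    (continuous_apply i).comp hg
  -- `v` is `w` minus the noise; it is differentiable, so the ordinary product rule suffices.
  set v : ℝ → Fin N → ℝ :=
    fun s i => w₀ i + ∫ r in (0 : ℝ)..s, (M (max r 0)).mulVec (w r.toNNReal) i with hv
  have hvd : ∀ s i, HasDerivAt (fun s => v s i) ((M (max s 0)).mulVec (w s.toNNReal) i) s :=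
    fun s i => ((hgi i).integral_hasStrictDerivAt 0 s).hasDerivAt.const_add _
  have hvw : ∀ s, 0 ≤ s → w s.toNNReal = v s + b s.toNNReal := by
    intro s hs
    funext i
    rw [hweq, Real.coe_toNNReal s hs, Pi.add_apply, hv]
    have : ∫ r in (0 : ℝ)..s, (driftMatrix lam (c • z) r).mulVec (w r.toNNReal) i
        = ∫ r in (0 : ℝ)..s, (M (max r 0)).mulVec (w r.toNNReal) i := by
      refine intervalIntegral.integral_congr fun r hr => ?_
      have hr0 : 0 ≤ r := Icc_zero_subset_Ici hs hr
      simp only [hM, max_eq_left hr0, driftMatrix_smul_hermiteZeros hz hlam hc hr0]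
    rw [this]
    ring
  have hderiv : ∀ s, 0 ≤ s →
      HasDerivAt (fun s => f s ⬝ᵥ v s) (-∑ i, b s.toNNReal i * f' s i) s := by
    intro s hs
    have h1 : HasDerivAt (fun s => f s ⬝ᵥ v s)
        (∑ i, (f' s i * v s i + f s i * (M (max s 0)).mulVec (w s.toNNReal) i)) s :=
      HasDerivAt.fun_sum fun i _ => (hasDerivAt_pi.1 (hf s) i).mul (hvd s i)
    refine h1.congr_deriv ?_
    have h2 : ∑ i, (f' s i * v s i + f s i * (M (max s 0)).mulVec (w s.toNNReal) i)
        = f' s ⬝ᵥ v s + f s ⬝ᵥ (M s).mulVec (w s.toNNReal) := by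
      rw [Finset.sum_add_distrib, max_eq_left hs]
      rfl
    have h3 : ∑ i, b s.toNNReal i * f' s i = f' s ⬝ᵥ b s.toNNReal := by
      rw [dotProduct_comm]
      rfl
    -- By the adjoint equation and the symmetry of `M` the terms in `v` cancel, leaving only `M f ⬝ᵥ
    -- b = -f' ⬝ᵥ b`.
    have h4 : f' s = -(M s).mulVec (f s) := hff' s hs
    rw [h2, h3, hvw s hs, ← dotProduct_mulVec_comm (hMsymm s), h4, dotProduct_add, neg_dotProduct,
      neg_dotProduct]
    ring
  have hcont : ∀ i, Continuous fun s : ℝ => b s.toNNReal i * f' s i := fun i => by fun_prop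
  have hsum : Continuous fun s : ℝ => -∑ i, b s.toNNReal i * f' s i := by fun_prop
  have hint := intervalIntegral.integral_eq_sub_of_hasDerivAt
    (fun s hs => hderiv s (Icc_zero_subset_Ici t.coe_nonneg hs))
    (hsum.intervalIntegrable 0 (t : ℝ))
  rw [intervalIntegral.integral_neg, intervalIntegral.integral_finsetSum
    fun i _ => (hcont i).intervalIntegrable _ _] at hint
  have hv0 : v 0 = w₀ := by
    funext i
    simp [hv]
  have hwt := hvw t t.coe_nonneg
  rw [Real.toNNReal_coe] at hwt
  rw [hv0] at hint
  rw [Finset.sum_sub_distrib, hwt, dotProduct_add]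
  change f t ⬝ᵥ v t + f t ⬝ᵥ b t = _ + (f t ⬝ᵥ b t - _)
  linarith

variable {Ω : Type*} [MeasurableSpace Ω] {P : Measure Ω} {B W : ℝ≥0 → Ω → Fin N → ℝ}

lemma IsBrownian.ae_continuous (hB : IsBrownian B P) : ∀ᵐ ω ∂P, Continuous fun t => B t ω := by
  have hc : ∀ᵐ ω ∂P, ∀ i, Continuous fun t => B t ω i := ae_all_iff.2 fun i => (hB.coord i).cont
  filter_upwards [hc] with ω hω using continuous_pi hω

/-- The solutions of the linear equation are Gaussian. -/
lemma IsFluctuation.exists_hasLaw_dotProduct (hB : IsBrownian B P) (hz : IsHermiteZeros z)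
    (hlam : lam ≠ 0) (hc : 0 < c) {w₀ : Fin N → ℝ} (hW : IsFluctuation lam (c • z) w₀ B W P)
    (t : ℝ≥0) (u : Fin N → ℝ) :
    ∃ μ : ℝ, HasLaw (fun ω => u ⬝ᵥ W t ω) (gaussianReal μ
      (u ⬝ᵥ (limitCov (interactionMatrix z) lam c t).mulVec u).toNNReal) P := by
  obtain ⟨f, f', hf, hf', hff'⟩ :=
    exists_adjointFlow_extension (interactionMatrix z) u hlam hc t.coe_nonneg
  have hft : f t = u := by
    rw [(hff' t t.coe_nonneg).1, adjointFlow_self _ _ hc t.coe_nonneg]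
  have hvar : ∫ s in (0 : ℝ)..t, f s ⬝ᵥ f s
      = u ⬝ᵥ (limitCov (interactionMatrix z) lam c t).mulVec u := by
    rw [← integral_adjointFlow_dotProduct_self u (interactionMatrix_isSymm z)
      (isUnit_one_sub_interactionMatrix z) hlam hc t.coe_nonneg]
    refine intervalIntegral.integral_congr fun s hs => ?_
    simp only [(hff' s (Icc_zero_subset_Ici t.coe_nonneg hs)).1]
  have hlaw := gaussianReal_const_add (hB.hasLaw_integral hf hf' t.coe_nonneg) (f 0 ⬝ᵥ w₀)
  rw [hvar] at hlaw
  refine ⟨_, hlaw.congr ?_⟩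
  filter_upwards [hW, hB.ae_continuous] with ω hω hb
  have h := dotProduct_fluctuation_eq hz hlam hc hb hω.1 hω.2 hf hf'
    (fun s hs => (hff' s hs).2) t
  rw [hft] at h
  rw [h, Real.toNNReal_coe, hft]

/-- Ensures that `Real.toNNReal` in the Gaussian law does not truncate the variance. -/
lemma limitCov_quadratic_nonneg (hlam : lam ≠ 0) (hc : 0 < c) {t : ℝ} (ht : 0 ≤ t)
    (u : Fin N → ℝ) : 0 ≤ u ⬝ᵥ (limitCov (interactionMatrix z) lam c t).mulVec u := by
  rw [← integral_adjointFlow_dotProduct_self u (interactionMatrix_isSymm z)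
    (isUnit_one_sub_interactionMatrix z) hlam hc ht]
  exact intervalIntegral.integral_nonneg ht fun s _ =>
    Finset.sum_nonneg fun i _ => mul_self_nonneg _

lemma IsFluctuation.memLp_dotProduct (hB : IsBrownian B P) (hz : IsHermiteZeros z)
    (hlam : lam ≠ 0) (hc : 0 < c) {w₀ : Fin N → ℝ} (hW : IsFluctuation lam (c • z) w₀ B W P)
    (t : ℝ≥0) (u : Fin N → ℝ) : MemLp (fun ω => u ⬝ᵥ W t ω) 2 P := by
  obtain ⟨μ, hμ⟩ := hW.exists_hasLaw_dotProduct hB hz hlam hc t u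
  exact hμ.hasGaussianLaw.memLp_two

lemma IsFluctuation.variance_dotProduct (hB : IsBrownian B P) (hz : IsHermiteZeros z)
    (hlam : lam ≠ 0) (hc : 0 < c) {w₀ : Fin N → ℝ} (hW : IsFluctuation lam (c • z) w₀ B W P)
    (t : ℝ≥0) (u : Fin N → ℝ) : Var[fun ω => u ⬝ᵥ W t ω; P]
      = u ⬝ᵥ (limitCov (interactionMatrix z) lam c t).mulVec u := by
  obtain ⟨μ, hμ⟩ := hW.exists_hasLaw_dotProduct hB hz hlam hc t u
  rw [hμ.variance_eq, variance_id_gaussianReal,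
    Real.coe_toNNReal _ (limitCov_quadratic_nonneg hlam hc t.coe_nonneg u)]

lemma IsFluctuation.memLp (hB : IsBrownian B P) (hz : IsHermiteZeros z)
    (hlam : lam ≠ 0) (hc : 0 < c) {w₀ : Fin N → ℝ} (hW : IsFluctuation lam (c • z) w₀ B W P)
    (t : ℝ≥0) (i : Fin N) : MemLp (fun ω => W t ω i) 2 P := by
  simpa using hW.memLp_dotProduct hB hz hlam hc t (Pi.single i 1)

/-- Polarization: the variances along `e_i`, `e_j` and `e_i + e_j` determine the covariance, as
`limitCov` is symmetric. -/
theorem IsFluctuation.covMatrix_eq (hB : IsBrownian B P) (hz : IsHermiteZeros z)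
    (hlam : lam ≠ 0) (hc : 0 < c) {w₀ : Fin N → ℝ} (hW : IsFluctuation lam (c • z) w₀ B W P)
    (t : ℝ≥0) : covMatrix (W t) P = limitCov (interactionMatrix z) lam c t := by
  have := hB.indep.isProbabilityMeasure
  ext i j
  have hL := hW.memLp hB hz hlam hc t
  have hi := hW.variance_dotProduct hB hz hlam hc t (Pi.single i 1)
  have hj := hW.variance_dotProduct hB hz hlam hc t (Pi.single j 1)
  have hij := hW.variance_dotProduct hB hz hlam hc t (Pi.single i 1 + Pi.single j 1)
  have hadd := variance_add (hL i) (hL j)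
  have hsymm := (limitCov_isSymm (lam := lam) (c := c) (t := t) (interactionMatrix_isSymm z)
    (isUnit_one_sub_interactionMatrix z)).apply i j
  simp only [Matrix.mulVec_add, add_dotProduct, dotProduct_add, single_dotProduct, one_mul,
    Matrix.mulVec_single_one, Matrix.col_apply] at hi hj hij
  change Var[fun ω => W t ω i + W t ω j; P] = _ at hadd
  rw [covMatrix, Matrix.of_apply]
  linarith

end BesselOU

theorem lemma6p2 {N : ℕ} {Ω : Type*} [MeasurableSpace Ω] (P : Measure Ω) [IsProbabilityMeasure P]
    (B : ℝ≥0 → Ω → Fin N → ℝ) (hB : BesselOU.IsBrownian B P)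
    (z : Fin N → ℝ) (hz : BesselOU.IsHermiteZeros z)
    (lam c : ℝ) (hlam : lam ≠ 0) (hc : 0 < c) (y : Fin N → ℝ)
    (k₀ : ℝ) (hk₀ : 1 / 2 ≤ k₀)
    (hstart : ∀ k, k₀ ≤ k → √k • c • z + y ∈ interior (BesselOU.chamber N))
    (Y : ℝ → ℝ≥0 → Ω → Fin N → ℝ)
    (hY : ∀ k, k₀ ≤ k → BesselOU.IsBesselOU lam k (√k • c • z + y) B (Y k) P) :
    -- every solution of the linear SDE with start in `y` is the limit process of the `Y k`
    (∀ W : ℝ≥0 → Ω → Fin N → ℝ, BesselOU.IsFluctuation lam (c • z) y B W P →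
      ∀ k : ℕ → ℝ, (∀ n, k₀ ≤ k n) → Tendsto k atTop atTop →
        ∀ᵐ ω ∂P, TendstoLocallyUniformly
          (fun n t => √(k n) • ((√(k n))⁻¹ • Y (k n) t ω - BesselOU.flowOU lam (c • z) t))
          (fun t => W t ω) atTop) ∧
    -- the inverse in the covariance formula is a true inverse
    IsUnit (1 - BesselOU.interactionMatrix z) ∧
    -- the covariance formula, whatever the deterministic initial value is
    (∀ (w : Fin N → ℝ) (W : ℝ≥0 → Ω → Fin N → ℝ),
      BesselOU.IsFluctuation lam (c • z) w B W P → ∀ t : ℝ≥0, 0 < t →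
        (∀ i, MemLp (fun ω => W t ω i) 2 P) ∧
        BesselOU.covMatrix (W t) P =
          ((1 + Real.exp (-2 * lam * t) * (lam * c ^ 2 - 1)) / (2 * lam)) •
            ((1 - BesselOU.interactionMatrix z)⁻¹ *
              (1 - NormedSpace.exp
                (Real.log (lam * c ^ 2 / (Real.exp (2 * lam * t) - 1 + lam * c ^ 2)) •
                  (1 - BesselOU.interactionMatrix z))))) := by
  refine ⟨fun W hW k hk hktop => ?_, BesselOU.isUnit_one_sub_interactionMatrix z,
    fun w W hW t _ => ⟨hW.memLp hB hz hlam hc t, hW.covMatrix_eq hB hz hlam hc t⟩⟩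
  -- Only countably many `k n` occur, so one null set serves them all.
  have hYn := ae_all_iff.2 fun n => hY (k n) (hk n)
  filter_upwards [hW, hB.ae_continuous, hYn] with ω hωW hωB hωY
  exact BesselOU.tendstoLocallyUniformly_deviation hz hlam hc hωB hωW.1 hωW.2
    (fun n => by linarith [hk n]) hktop (fun n => (hωY n).1) fun n => (hωY n).2.2
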